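/- Let $r>0$, $\sigma>0$, and let $Z$ have the symmetric variance-gamma law $\mathrm{VG}(r,0,\sigma,0)$ on $\mathbb{R}$, with density $$p(x)=\frac{1}{\sigma\sqrt{\pi}\,\Gamma(\frac r2)}\Big(\frac{|x|}{2\sigma}\Big)^{\nu}K_{\nu}\Big(\frac{|x|}{\sigma}\Big),\qquad \nu=\frac{r-1}{2},$$ where $K_\nu(x)=\int_0^\infty e^{-x\cosh t}\cosh(\nu t)\,dt$ and $I_\nu(x)=\sum_{k\ge0}\frac{1}{k!\,\Gamma(\nu+k+1)}(\frac x2)^{\nu+2k}$ are the modified Bessel functions. For a bounded Borel function $h$ put $\tilde h=h-\mathbb{E}h(Z)$, and let $$f(x)=-\frac{K_\nu(|x|/\sigma)}{\sigma^2|x|^\nu}\int_0^x|t|^\nu I_\nu(|t|/\sigma)\tilde h(t)\,dt-\frac{I_\nu(|x|/\sigma)}{\sigma^2|x|^\nu}\int_x^\infty|t|^\nu K_\nu(|t|/\sigma)\tilde h(t)\,dt\qquad(x\ne0),$$ extended by continuity to $x=0$. Write $\|g\|=\sup_x|g(x)|$ (over the points where $g$ exists, if $g$ is a derivative that does not exist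 everywhere), $(x)_{n,k}=x(x+k)\cdots(x+(n-1)k)$, and $n!!$ for the double factorial, with $(-1)!!=0!!=1$. Let $C_b^n(\mathbb{R})$ be the class of functions $h$ such that $h^{(n-1)}$ exists and is (locally) absolutely continuous and the derivatives of $h$ up to order $n$ are bounded; $C_b^0(\mathbb{R})$ is the class of bounded Borel functions. (a) If $h\in C_b^0(\mathbb R)$, then $f$ is continuous on $\mathbb R$, is differentiable on $\mathbb{R}\setminus\{0\}$, and solves the Stein equation $$\sigma^2xf''(x)+\sigma^2rf'(x)-xf(x)=\tilde h(x)$$ for almost every $x$. At every point $x$ where $h$ is continuous, $f$ is differentiable, $f''$ exists if $x\neq 0$, and the equation holds (for $x=0$ it reads $\sigma^2 r f'(0)=\tilde h(0)$). (b) Let $n\ge 0$ and let $h\in C_b^{n-1}(\mathbb{R})$ (for $n=0$: $h\in C_b^0(\mathbb R)$). Then $f\in C^{n-1}(\mathbb{R})$ and $f^{(n)}$ exists on $\mathbb{R}\setminus\{0\}$ (for $n=0$: $f$ is continuous on $\mathbb R$ and differentiable on $\mathbb R\setminus\{0\}$). If $n=2k+1$, then $$\|f^{(2k+1)}\|\le\sum_{j=0}^k\frac{(2k)!!}{(2j)!!}\,\frac{1}{(r+2j)_{k-j+1,2}}\Big(\frac{2}{\sigma^2}\Big)^{k-j+1}\|\tilde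 h^{(2j)}\|,$$ and if $n=2k$, then $$\|f^{(2k)}\|\le\sum_{j=1}^k\frac{(2k-1)!!}{(2j-1)!!}\,\frac{1}{(r+2j-1)_{k-j+1,2}}\Big(\frac{2}{\sigma^2}\Big)^{k-j+1}\|h^{(2j-1)}\|+\frac{(2k-1)!!\,2^k}{(r+1)_{k,2}\,\sigma^{2k+1}}\Big(\frac1r+\frac{\pi\Gamma(\frac r2)}{2\Gamma(\frac{r+1}2)}\Big)\|\tilde h\|.$$ (c) For fixed $\sigma$ and $n\ge1$ the bounds in (b) decay like $(r+n)^{-1}$, in the following sense. The coefficient of the norm of the highest derivative (index $j=k$ of the sum) is at least $c/(r+n)$ for all $r>0$ and $n\geq 1$, with a constant $c>0$ depending only on $\sigma$. For every fixed $m\ge0$ the coefficient with index $j=k-m$ of the sum (where $k\ge m$ for $n=2k+1$ and $k\ge m+1$ for $n=2k$) is $O((r+n)^{-1})$ as $r+n\to\infty$, jointly in $r>0$ and $n$, with constants depending only on $\sigma$ and $m$. For every fixed even $n=2k\ge2$ the coefficient of $\|\tilde h\|$ in the second bound is $O((r+n)^{-1})$ as $r\to\infty$. -/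

import Mathlib

open MeasureTheory
open scoped Nat

noncomputable section

/-- The supremum norm `‖g‖ = sup_x |g x|` of a (bounded) function on the real line. -/
def supNorm (g : ℝ → ℝ) : ℝ := ⨆ x : ℝ, |g x|

/-- The Pochhammer `k`-symbol `(x)_{n,k} = x (x + k) (x + 2k) ⋯ (x + (n - 1) k)`. -/
def pochhammerK (x : ℝ) (n : ℕ) (k : ℝ) : ℝ := ∏ i ∈ Finset.range n, (x + i * k)

/-- The class `C_b^n(ℝ)`: the derivative `h^{(n-1)}` exists everywhere and is (locally) absolutely
continuous, and the derivatives of order `0, …, n` are bounded. The derivative of order `n` exists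
almost everywhere only; `iteratedDeriv n h` vanishes by convention where it does not exist, so the
bound of order `n` is a bound at the points where `h^{(n)}` exists.
For `n = 0` these are the bounded Borel functions. -/
structure MemCb (n : ℕ) (h : ℝ → ℝ) : Prop where
  measurable : Measurable h
  differentiable : ∀ m : ℕ, m + 1 < n → Differentiable ℝ (iteratedDeriv m h)
  absolutelyContinuous : ∀ m : ℕ, m + 1 = n →
    ∀ a b : ℝ, AbsolutelyContinuousOnInterval (iteratedDeriv m h) a b
  bounded : ∀ m : ℕ, m ≤ n → ∃ C : ℝ, ∀ x : ℝ, |iteratedDeriv m h x| ≤ C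

/-- The modified Bessel function of the second kind `K_ν(x)`, `x > 0`. -/
def besselK (ν x : ℝ) : ℝ :=
  ∫ t in Set.Ioi (0 : ℝ), Real.exp (-x * Real.cosh t) * Real.cosh (ν * t)

/-- The modified Bessel function of the first kind `I_ν(x)`, `x > 0`, `ν > -1`. -/
def besselI (ν x : ℝ) : ℝ :=
  ∑' k : ℕ, 1 / ((k ! : ℝ) * Real.Gamma (ν + k + 1)) * (x / 2) ^ (ν + 2 * (k : ℝ))

/-- The density of the symmetric variance-gamma law `VG(r, 0, σ, 0)`. -/
def vgDensity (r σ x : ℝ) : ℝ :=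
  1 / (σ * √Real.pi * Real.Gamma (r / 2)) * (|x| / (2 * σ)) ^ ((r - 1) / 2) *
    besselK ((r - 1) / 2) (|x| / σ)

/-- The centred test function `h̃ = h - 𝔼 h(Z)`, where `Z ∼ VG(r, 0, σ, 0)`. -/
def vgCentred (r σ : ℝ) (h : ℝ → ℝ) (x : ℝ) : ℝ :=
  h x - ∫ y, h y * vgDensity r σ y

/-- The Stein operator `L_{r,0,σ} f(x) = σ² x f''(x) + σ² r f'(x) - x f(x)`. -/
def vgSteinOp (r σ : ℝ) (f : ℝ → ℝ) (x : ℝ) : ℝ :=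
  σ ^ 2 * x * deriv (deriv f) x + σ ^ 2 * r * deriv f x - x * f x

/-- The solution of the Stein equation `L_{r,0,σ} f = h̃`, given by its explicit formula for `x ≠ 0`
and extended by continuity to `x = 0`
(where `|x|^{-ν} I_ν(|x|/σ)` tends to `1 / ((2σ)^ν Γ(ν + 1))`). -/
def vgSolution (r σ : ℝ) (h : ℝ → ℝ) (x : ℝ) : ℝ :=
  let ν : ℝ := (r - 1) / 2
  if x = 0 then
    -(1 / (σ ^ 2 * ((2 * σ) ^ ν * Real.Gamma (ν + 1)))) *
      ∫ t in Set.Ioi (0 : ℝ), |t| ^ ν * besselK ν (|t| / σ) * vgCentred r σ h t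
  else
    -(1 / (σ ^ 2 * |x| ^ ν)) * besselK ν (|x| / σ) *
        (∫ t in (0 : ℝ)..x, |t| ^ ν * besselI ν (|t| / σ) * vgCentred r σ h t)
      - 1 / (σ ^ 2 * |x| ^ ν) * besselI ν (|x| / σ) *
        (∫ t in Set.Ioi x, |t| ^ ν * besselK ν (|t| / σ) * vgCentred r σ h t)

/-- `f` solves the Stein equation `L_{r,0,σ} f = h̃`. For a discontinuous `h` the equation holds
almost everywhere; it holds at every point at which `h` is continuous. -/
structure IsVGSteinSolution (r σ : ℝ) (h f : ℝ → ℝ) : Prop where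
  continuous : Continuous f
  differentiableAt : ∀ x : ℝ, x ≠ 0 → DifferentiableAt ℝ f x
  ae_eq : ∀ᵐ x : ℝ, DifferentiableAt ℝ (deriv f) x ∧ vgSteinOp r σ f x = vgCentred r σ h x
  eq_of_continuousAt : ∀ x : ℝ, ContinuousAt h x →
    DifferentiableAt ℝ f x ∧ (x ≠ 0 → DifferentiableAt ℝ (deriv f) x) ∧
      vgSteinOp r σ f x = vgCentred r σ h x

/-- The coefficient of `‖h̃^{(2j)}‖`, `0 ≤ j ≤ k`, in the bound for `‖f^{(2k+1)}‖`. -/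
def vgOddCoeff (r σ : ℝ) (k j : ℕ) : ℝ :=
  ((2 * k)‼ : ℝ) / ((2 * j)‼ : ℝ) * (1 / pochhammerK (r + 2 * j) (k - j + 1) 2) *
    (2 / σ ^ 2) ^ (k - j + 1)

/-- The coefficient of `‖h^{(2j-1)}‖`, `1 ≤ j ≤ k`, in the bound for `‖f^{(2k)}‖`. -/
def vgEvenCoeff (r σ : ℝ) (k j : ℕ) : ℝ :=
  ((2 * k - 1)‼ : ℝ) / ((2 * j - 1)‼ : ℝ) * (1 / pochhammerK (r + 2 * j - 1) (k - j + 1) 2) *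
    (2 / σ ^ 2) ^ (k - j + 1)

/-- The coefficient of `‖h̃‖` in the bound for `‖f^{(2k)}‖`. For `k = 0` the truncated expression
`(2 * 0 - 1)‼ = 0‼ = 1` agrees with the convention `(-1)‼ = 1`. -/
def vgEvenRem (r σ : ℝ) (k : ℕ) : ℝ :=
  ((2 * k - 1)‼ : ℝ) * 2 ^ k / (pochhammerK (r + 1) k 2 * σ ^ (2 * k + 1)) *
    (1 / r + Real.pi * Real.Gamma (r / 2) / (2 * Real.Gamma ((r + 1) / 2)))

end

/-! With `lam = 1 / σ²` the Stein equation is `x u'' + r u' = lam (x u + g)`, and multiplying by `x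
^ (r - 1)` gives `(x ^ r u')' = lam x ^ (r - 1) (x u + g)` on `(0, ∞)`. The homogeneous equation has
the increasing solution `A = x ^ (-ν) I_ν(x / σ)` and the decreasing solution `B = x ^ (-ν) K_ν(x /
σ)`. With `a = x ^ r A'` and `b = -x ^ r B'` the Wronskian relation is `a B + A b = 1`. The stated
`f` is variation of parameters with this pair.

Write `v = u'`. The derivatives of `X = x ^ r v A - u a` and `Y = x ^ r v B + u b` are `lam g x ^ (r
- 1)` times `A` and `B`. If `u` is bounded and `x ^ r v → 0` at the origin, then `X → 0` at `0` and
`Y → 0` at `∞`, so for `|g| ≤ M` both are bounded by `lam M` times integrals of `t ^ (r - 1) A` over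
`(0, x)` and of `t ^ (r - 1) B` over `(x, ∞)`. Solving back, `u = A Y - B X` and `x ^ r v = a Y + b
X`. Two inequalities finish the estimate: `b ∫₀ˣ t ^ (r - 1) A ≤ x ^ r / r` (`b_mul_intA_le`) and `a
∫ₓ^∞ t ^ (r - 1) B ≤ b ∫₀ˣ t ^ (r - 1) A` (`a_mul_intB_le`). They give `|u'| ≤ 2 lam M / r`. The
second also says that `A ∫ₓ^∞ t ^ (r - 1) B + B ∫₀ˣ t ^ (r - 1) A` is nonincreasing, so its limit at
`0` bounds `u` (`potential_le`).

Differentiating the equation replaces `r` by `r + 1` and `g` by `g' + u`, and the derivative again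
satisfies the hypotheses of the estimate. After `m` steps `f^(m)` solves the equation with parameter
`r + m` and right side `h̃^(m) + m f^(m-1)`, whence `‖f^(m+1)‖ ≤ 2 / (σ² (r + m)) (‖h̃^(m)‖ + m
‖f^(m-1)‖)`. This recursion preserves parity; unrolling it from `f'` or from `f` produces the double
factorials and the Pochhammer symbols with step `2`.

The negative half line is the positive one for `u(-x)` with right side `-g(-x)`. That `f` has the
same form there, and one value at `0`, is exactly the vanishing mean of `h̃`. Since `h` is only
measurable, everything is phrased with indefinite integrals, and second derivatives appear almost
everywhere or at continuity points. -/

/-! ### Indefinite integrals on `(0, ∞)`. -/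

section HalfLine
open Set Filter Topology

/-- `F` is an indefinite integral of the locally integrable function `k` on `(0, ∞)`. -/
def IsPrimitive (F k : ℝ → ℝ) : Prop :=
  ∀ a b : ℝ, 0 < a → 0 < b → IntervalIntegrable k volume a b ∧ F b - F a = ∫ t in a..b, k t

lemma uIcc_subset_Ioi_zero {a b : ℝ} (ha : 0 < a) (hb : 0 < b) : uIcc a b ⊆ Ioi 0 :=
  fun _ hx => lt_of_lt_of_le (lt_min ha hb) hx.1

namespace IsPrimitive

variable {F G k l : ℝ → ℝ}

lemma of_hasDerivAt (h : ∀ x, 0 < x → HasDerivAt F (k x) x) (hk : ContinuousOn k (Ioi 0)) :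
    IsPrimitive F k := fun a b ha hb => by
  have hi : IntervalIntegrable k volume a b :=
    (hk.mono (uIcc_subset_Ioi_zero ha hb)).intervalIntegrable
  exact ⟨hi, (intervalIntegral.integral_eq_sub_of_hasDerivAt
    (fun x hx => h x (uIcc_subset_Ioi_zero ha hb hx)) hi).symm⟩

lemma congr (h : IsPrimitive F k) (hF : ∀ x, 0 < x → F x = G x) (hk : ∀ x, 0 < x → k x = l x) :
    IsPrimitive G l := fun a b ha hb => by
  obtain ⟨h1, h2⟩ := h a b ha hb
  have e : EqOn k l (uIcc a b) := fun x hx => hk x (uIcc_subset_Ioi_zero ha hb hx)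
  refine ⟨h1.congr (fun x hx => e (uIoc_subset_uIcc hx)), ?_⟩
  rw [← hF a ha, ← hF b hb, h2, intervalIntegral.integral_congr e]

lemma add (hF : IsPrimitive F k) (hG : IsPrimitive G l) :
    IsPrimitive (fun x => F x + G x) (fun x => k x + l x) := fun a b ha hb => by
  obtain ⟨h1, h2⟩ := hF a b ha hb
  obtain ⟨h3, h4⟩ := hG a b ha hb
  refine ⟨h1.add h3, ?_⟩
  rw [intervalIntegral.integral_add h1 h3, ← h2, ← h4]; ring

lemma const_mul (c : ℝ) (hF : IsPrimitive F k) :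
    IsPrimitive (fun x => c * F x) (fun x => c * k x) := fun a b ha hb => by
  obtain ⟨h1, h2⟩ := hF a b ha hb
  refine ⟨h1.const_mul c, ?_⟩
  rw [intervalIntegral.integral_const_mul, ← h2]; ring

lemma neg (hF : IsPrimitive F k) : IsPrimitive (fun x => -F x) (fun x => -k x) :=
  (hF.const_mul (-1)).congr (fun _ _ => by ring) (fun _ _ => by ring)

lemma sub (hF : IsPrimitive F k) (hG : IsPrimitive G l) :
    IsPrimitive (fun x => F x - G x) (fun x => k x - l x) :=
  (hF.add hG.neg).congr (fun _ _ => by ring) (fun _ _ => by ring)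

lemma eq_add (h : IsPrimitive F k) {a x : ℝ} (ha : 0 < a) (hx : 0 < x) :
    F x = F a + ∫ t in a..x, k t := by
  rw [← (h a x ha hx).2]; ring

lemma absolutelyContinuousOnInterval (h : IsPrimitive F k) {a b : ℝ} (ha : 0 < a) (hb : 0 < b) :
    AbsolutelyContinuousOnInterval F a b := by
  have h1 := ((h a b ha hb).1).absolutelyContinuousOnInterval_intervalIntegral
    (c := a) left_mem_uIcc
  have h2 : LipschitzOnWith 0 (fun _ : ℝ => F a) (uIcc a b) :=
    LipschitzOnWith.of_dist_le_mul (by simp)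
  have h3 := h2.absolutelyContinuousOnInterval.add h1
  rw [absolutelyContinuousOnInterval_iff] at h3 ⊢
  intro ε hε
  obtain ⟨δ, hδ, H⟩ := h3 ε hε
  refine ⟨δ, hδ, fun E hE hEδ => ?_⟩
  convert H E hE hEδ using 3 with i hi
  · exact h.eq_add ha (uIcc_subset_Ioi_zero ha hb (hE.1 i hi).1)
  · exact h.eq_add ha (uIcc_subset_Ioi_zero ha hb (hE.1 i hi).2)

/-- Lebesgue differentiation on each interval `(1 / (n + 1), n + 1)`; countably many of these
exhaust the half line. -/
lemma ae_hasDerivAt (h : IsPrimitive F k) : ∀ᵐ x, 0 < x → HasDerivAt F (k x) x := by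
  have key : ∀ n : ℕ, ∀ᵐ x, x ∈ Ioo ((n + 1 : ℝ)⁻¹) (n + 1) → HasDerivAt F (k x) x := by
    intro n
    have hn : (0 : ℝ) < (n + 1 : ℝ)⁻¹ := by positivity
    have hn' : (0 : ℝ) < (n + 1 : ℝ) := by positivity
    have hle : (n + 1 : ℝ)⁻¹ ≤ n + 1 := by
      have : (1 : ℝ) ≤ n + 1 := by simp
      exact (inv_le_one_of_one_le₀ this).trans this
    filter_upwards [((h _ _ hn hn').1).ae_hasDerivAt_integral] with x hx hxI
    have hd := (hx (by rw [uIcc_of_le hle]; exact Ioo_subset_Icc_self hxI) _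
      left_mem_uIcc).const_add (F (n + 1 : ℝ)⁻¹)
    refine hd.congr_of_eventuallyEq ?_
    filter_upwards [Ioo_mem_nhds hxI.1 hxI.2] with y hy
    exact h.eq_add hn (hn.trans hy.1)
  filter_upwards [ae_all_iff.2 key] with x hx hx0
  obtain ⟨n, hn⟩ := exists_nat_gt (max x x⁻¹)
  have h1 : x < n := (le_max_left _ _).trans_lt hn
  have h2 : x⁻¹ < n := (le_max_right _ _).trans_lt hn
  refine hx n ⟨?_, by linarith⟩
  rw [inv_lt_comm₀ (by positivity) hx0]; linarith

lemma hasDerivAt (h : IsPrimitive F k) {x : ℝ} (hx : 0 < x) (hk : ContinuousAt k x) :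
    HasDerivAt F (k x) x := by
  have hi := (h (x / 2) (x + 1) (by positivity) (by positivity)).1
  have hmem : Ioc (x / 2) (x + 1) ∈ 𝓝 x := Ioc_mem_nhds (by linarith) (by linarith)
  have hm : StronglyMeasurableAtFilter k (𝓝 x) :=
    ⟨_, hmem, hi.1.aestronglyMeasurable⟩
  have hd := (intervalIntegral.integral_hasDerivAt_right
    (h (x / 2) x (by positivity) hx).1 hm hk).const_add (F (x / 2))
  refine hd.congr_of_eventuallyEq ?_
  filter_upwards [hmem] with y hy
  exact h.eq_add (by positivity) ((by positivity : (0:ℝ) < x / 2).trans hy.1)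

lemma continuousOn (h : IsPrimitive F k) : ContinuousOn F (Ioi 0) := fun x hx => by
  have hx : 0 < x := hx
  have hc := (h.absolutelyContinuousOnInterval (a := x / 2) (b := x + 1)
    (by positivity) (by positivity)).continuousOn
  rw [uIcc_of_le (by linarith)] at hc
  exact (hc.continuousAt (Icc_mem_nhds (by linarith) (by linarith))).continuousWithinAt

/-- Integration by parts for absolutely continuous functions. It lets the Wronskian-type
combinations be differentiated although the right side of the equation is merely measurable. -/
lemma mul (hF : IsPrimitive F k) (hG : IsPrimitive G l) :
    IsPrimitive (fun x => F x * G x) (fun x => k x * G x + F x * l x) := fun a b ha hb => by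
  have h1 := hF.absolutelyContinuousOnInterval ha hb
  have h2 := hG.absolutelyContinuousOnInterval ha hb
  refine ⟨((hF a b ha hb).1.mul_continuousOn h2.continuousOn).add
    ((hG a b ha hb).1.continuousOn_mul h1.continuousOn), ?_⟩
  rw [← h1.integral_deriv_mul_eq_sub h2]
  apply intervalIntegral.integral_congr_ae
  filter_upwards [hF.ae_hasDerivAt, hG.ae_hasDerivAt] with x hx1 hx2 hx
  have hx0 := uIcc_subset_Ioi_zero ha hb (uIoc_subset_uIcc hx)
  rw [(hx1 hx0).deriv, (hx2 hx0).deriv]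

/-- A pointwise bound on the integrand bounds the increments of the primitive. -/
lemma abs_sub_le (hF : IsPrimitive F k) (hG : IsPrimitive G l)
    {a b : ℝ} (ha : 0 < a) (hab : a ≤ b) (hkl : ∀ x ∈ Icc a b, |k x| ≤ l x) :
    |F b - F a| ≤ G b - G a := by
  have hb := ha.trans_le hab
  rw [(hF a b ha hb).2, (hG a b ha hb).2]
  refine (intervalIntegral.abs_integral_le_integral_abs hab).trans ?_
  exact intervalIntegral.integral_mono_on hab (hF a b ha hb).1.abs (hG a b ha hb).1
    hkl

lemma sub_le_sub (hF : IsPrimitive F k) (hG : IsPrimitive G l) {a b : ℝ} (ha : 0 < a)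
    (hab : a ≤ b) (hkl : ∀ x ∈ Icc a b, k x ≤ l x) : F b - F a ≤ G b - G a := by
  have hb := ha.trans_le hab
  rw [(hF a b ha hb).2, (hG a b ha hb).2]
  exact intervalIntegral.integral_mono_on hab (hF a b ha hb).1 (hG a b ha hb).1 hkl

lemma of_integrableOn_Ioi (hk : IntegrableOn k (Ioi 0)) :
    IsPrimitive (fun x => ∫ t in Ioi x, k t) (fun x => -k x) := fun a b ha hb => by
  have ia : IntegrableOn k (Ioi a) := hk.mono_set (Ioi_subset_Ioi ha.le)
  have ib : IntegrableOn k (Ioi b) := hk.mono_set (Ioi_subset_Ioi hb.le)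
  have hi : IntervalIntegrable k volume a b :=
    ⟨ia.mono_set Ioc_subset_Ioi_self, ib.mono_set Ioc_subset_Ioi_self⟩
  refine ⟨hi.neg, ?_⟩
  rw [intervalIntegral.integral_neg, ← intervalIntegral.integral_Ioi_sub_Ioi' ia ib]; ring

lemma of_intervalIntegrable (hk : ∀ x, 0 < x → IntervalIntegrable k volume 0 x) :
    IsPrimitive (fun x => ∫ t in (0 : ℝ)..x, k t) k := fun a b ha hb =>
  ⟨(hk a ha).symm.trans (hk b hb),
    intervalIntegral.integral_interval_sub_left (hk b hb) (hk a ha)⟩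

end IsPrimitive

lemma tendsto_intervalIntegral_zero_right {k : ℝ → ℝ} (hk : IntervalIntegrable k volume 0 1) :
    Tendsto (fun x => ∫ t in (0 : ℝ)..x, k t) (𝓝[>] 0) (𝓝 0) := by
  have h := (hk.absolutelyContinuousOnInterval_intervalIntegral
    (c := 0) left_mem_uIcc).continuousOn 0 left_mem_uIcc
  rw [uIcc_of_le zero_le_one] at h
  have h' := h.tendsto
  simp only [intervalIntegral.integral_same] at h'
  refine h'.mono_left (nhdsWithin_le_of_mem ?_)
  exact mem_of_superset (Ioo_mem_nhdsGT one_pos) Ioo_subset_Icc_self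

end HalfLine

/-! ### Abstract fundamental systems and their integral inequalities. -/

section Kernel
open Set Filter Topology

/-- A fundamental system `A`, `B` of `(x ^ r u')' = lam x ^ r u` on `(0, ∞)`, with
`a = x ^ r A'`, `b = -x ^ r B'`, where `A` is regular at `0` and `B` decays at `∞`. -/
structure SteinKernel (r lam : ℝ) (A B a b : ℝ → ℝ) (A₀ : ℝ) : Prop where
  r_pos : 0 < r
  lam_pos : 0 < lam
  A_deriv : ∀ x, 0 < x → HasDerivAt A (a x / x ^ r) x
  a_deriv : ∀ x, 0 < x → HasDerivAt a (lam * x ^ r * A x) x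
  B_deriv : ∀ x, 0 < x → HasDerivAt B (-(b x / x ^ r)) x
  b_deriv : ∀ x, 0 < x → HasDerivAt b (-(lam * x ^ r * B x)) x
  A_pos : ∀ x, 0 < x → 0 < A x
  B_pos : ∀ x, 0 < x → 0 < B x
  a_nonneg : ∀ x, 0 < x → 0 ≤ a x
  b_nonneg : ∀ x, 0 < x → 0 ≤ b x
  wronskian : ∀ x, 0 < x → a x * B x + A x * b x = 1
  A_zero : Tendsto A (𝓝[>] 0) (𝓝 A₀)
  a_zero : Tendsto a (𝓝[>] 0) (𝓝 0)
  b_infty : Tendsto b atTop (𝓝 0)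
  B_infty : Tendsto (fun x => x ^ (r + 1) * B x) atTop (𝓝 0)
  B_int : IntegrableOn (fun t => t ^ (r - 1) * B t) (Ioi 0)

/-- A bounded solution `u`, with derivative `v`, of `x u'' + r u' = lam (x u + g)` on `(0, ∞)`, in
the integrated form `(x ^ r v)' = lam x ^ (r - 1) (x u + g)`, such that `x ^ r v → 0` at `0`. -/
structure HalfSol (r lam : ℝ) (g u v : ℝ → ℝ) : Prop where
  deriv : ∀ x, 0 < x → HasDerivAt u (v x) x
  prim : IsPrimitive (fun x => x ^ r * v x) (fun t => lam * t ^ (r - 1) * (t * u t + g t))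
  bdd : ∃ C, ∀ x, 0 < x → |u x| ≤ C
  zero : Tendsto (fun x => x ^ r * v x) (𝓝[>] 0) (𝓝 0)

lemma rpow_sub_one_mul_self {r x : ℝ} (hx : 0 < x) : x ^ (r - 1) * x = x ^ r := by
  rw [Real.rpow_sub_one hx.ne', div_mul_cancel₀ _ hx.ne']

lemma continuousOn_rpow_Ioi (s : ℝ) : ContinuousOn (fun x : ℝ => x ^ s) (Ioi 0) :=
  fun x hx => (Real.continuousAt_rpow_const x s (Or.inl (ne_of_gt hx))).continuousWithinAt

lemma tendsto_rpow_zero_right {r : ℝ} (hr : 0 < r) :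
    Tendsto (fun x : ℝ => x ^ r) (𝓝[>] 0) (𝓝 0) := by
  have h := (Real.continuousAt_rpow_const (0 : ℝ) r (Or.inr hr.le)).tendsto
  rw [Real.zero_rpow hr.ne'] at h
  exact h.mono_left nhdsWithin_le_nhds

lemma continuousOn_Ioi_of_hasDerivAt {f f' : ℝ → ℝ} (h : ∀ x, 0 < x → HasDerivAt f (f' x) x) :
    ContinuousOn f (Ioi 0) := fun x hx => (h x hx).continuousAt.continuousWithinAt

lemma isPrimitive_rpow (r : ℝ) :
    IsPrimitive (fun x => x ^ r) (fun x => r * x ^ (r - 1)) :=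
  .of_hasDerivAt (fun _ hx => Real.hasDerivAt_rpow_const (Or.inl hx.ne'))
    (continuousOn_const.mul (continuousOn_rpow_Ioi _))

/-- To prove an inequality of limits at `0` from the right. -/
lemma le_of_tendsto_zero_right {f h : ℝ → ℝ} {c d x : ℝ} (hx : 0 < x)
    (hf : Tendsto f (𝓝[>] 0) (𝓝 c)) (hh : Tendsto h (𝓝[>] 0) (𝓝 d))
    (H : ∀ y, 0 < y → y ≤ x → f y ≤ h y) : c ≤ d :=
  le_of_tendsto_of_tendsto hf hh (by
    filter_upwards [Ioc_mem_nhdsGT hx] with y hy using H y hy.1 hy.2)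

namespace SteinKernel

variable {r lam A₀ : ℝ} {A B a b : ℝ → ℝ} (K : SteinKernel r lam A B a b A₀)
include K

lemma A_continuousOn : ContinuousOn A (Ioi 0) := continuousOn_Ioi_of_hasDerivAt K.A_deriv
lemma B_continuousOn : ContinuousOn B (Ioi 0) := continuousOn_Ioi_of_hasDerivAt K.B_deriv
lemma a_continuousOn : ContinuousOn a (Ioi 0) := continuousOn_Ioi_of_hasDerivAt K.a_deriv
lemma b_continuousOn : ContinuousOn b (Ioi 0) := continuousOn_Ioi_of_hasDerivAt K.b_deriv

lemma A_prim : IsPrimitive A (fun x => a x / x ^ r) :=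
  .of_hasDerivAt K.A_deriv (K.a_continuousOn.div (continuousOn_rpow_Ioi r)
    fun _ hx => (Real.rpow_pos_of_pos hx r).ne')

lemma B_prim : IsPrimitive B (fun x => -(b x / x ^ r)) :=
  .of_hasDerivAt K.B_deriv (K.b_continuousOn.div (continuousOn_rpow_Ioi r)
    fun _ hx => (Real.rpow_pos_of_pos hx r).ne').neg

lemma a_prim : IsPrimitive a (fun x => lam * x ^ r * A x) :=
  .of_hasDerivAt K.a_deriv ((continuousOn_const.mul (continuousOn_rpow_Ioi r)).mul
    K.A_continuousOn)

lemma b_prim : IsPrimitive b (fun x => -(lam * x ^ r * B x)) :=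
  .of_hasDerivAt K.b_deriv ((continuousOn_const.mul (continuousOn_rpow_Ioi r)).mul
    K.B_continuousOn).neg

lemma A_mono {x y : ℝ} (hx : 0 < x) (hxy : x ≤ y) : A x ≤ A y := by
  -- The constant function `0` serves as the comparison primitive, so a sign of the derivative
  -- yields monotonicity.
  have h := (isPrimitive_rpow 0).const_mul 0 |>.sub_le_sub K.A_prim hx hxy fun t ht => by
    have ht0 := hx.trans_le ht.1
    simpa using div_nonneg (K.a_nonneg t ht0) (Real.rpow_pos_of_pos ht0 r).le
  linarith

lemma B_anti {x y : ℝ} (hx : 0 < x) (hxy : x ≤ y) : B y ≤ B x := by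
  have h := K.B_prim.sub_le_sub ((isPrimitive_rpow 0).const_mul 0) hx hxy fun t ht => by
    have ht0 := hx.trans_le ht.1
    simpa using div_nonneg (K.b_nonneg t ht0) (Real.rpow_pos_of_pos ht0 r).le
  linarith

/-- As `A` increases, the integrand on `(0, x)` is dominated by `A x * M * t ^ (r - 1)`, integrable
because `r > 0`. -/
lemma intervalIntegrable_A {g : ℝ → ℝ} {M : ℝ} (hg : Measurable g)
    (hM : ∀ x, 0 < x → |g x| ≤ M) {x : ℝ} (hx : 0 < x) :
    IntervalIntegrable (fun t => t ^ (r - 1) * A t * g t) volume 0 x := by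
  have h1 : IntervalIntegrable (fun t : ℝ => A x * M * t ^ (r - 1)) volume 0 x :=
    (intervalIntegral.intervalIntegrable_rpow' (by linarith [K.r_pos])).const_mul _
  refine h1.mono_fun' ?_ ?_
  · rw [uIoc_of_le hx.le]
    refine AEStronglyMeasurable.mul (ContinuousOn.aestronglyMeasurable ?_ measurableSet_Ioc)
      hg.aestronglyMeasurable
    exact ((continuousOn_rpow_Ioi _).mul K.A_continuousOn).mono fun t ht => ht.1
  · rw [uIoc_of_le hx.le]
    filter_upwards [ae_restrict_mem measurableSet_Ioc] with t ht
    have h0 := Real.rpow_pos_of_pos ht.1 (r - 1)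
    have hA := K.A_pos t ht.1
    rw [Real.norm_eq_abs, abs_mul, abs_mul, abs_of_pos h0, abs_of_pos hA,
      mul_comm (A x * M), mul_assoc]
    have hx' := K.A_pos x hx
    gcongr
    · exact K.A_mono ht.1 ht.2
    · exact hM t ht.1

lemma integrableOn_B {g : ℝ → ℝ} {M : ℝ} (hg : Measurable g) (hM : ∀ x, 0 < x → |g x| ≤ M) :
    IntegrableOn (fun t => t ^ (r - 1) * B t * g t) (Ioi 0) :=
  Integrable.mul_bdd (c := M) K.B_int hg.aestronglyMeasurable (by
    filter_upwards [ae_restrict_mem measurableSet_Ioi] with t ht using hM t ht)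

/-- The integral of the regular solution against the weight. -/
lemma intA_prim : IsPrimitive (fun x => ∫ t in (0 : ℝ)..x, t ^ (r - 1) * A t)
    (fun t => t ^ (r - 1) * A t) :=
  .of_intervalIntegrable fun x hx => by
    simpa using K.intervalIntegrable_A (g := fun _ => 1) (M := 1) measurable_const (by simp) hx

lemma intA_zero : Tendsto (fun x => ∫ t in (0 : ℝ)..x, t ^ (r - 1) * A t) (𝓝[>] 0) (𝓝 0) :=
  tendsto_intervalIntegral_zero_right (by
    simpa using K.intervalIntegrable_A (g := fun _ => 1) (M := 1) measurable_const (by simp)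
      one_pos)

lemma intB_prim : IsPrimitive (fun x => ∫ t in Ioi x, t ^ (r - 1) * B t)
    (fun t => -(t ^ (r - 1) * B t)) := .of_integrableOn_Ioi K.B_int

omit K in
lemma tendsto_integral_Ioi_zero_right {k : ℝ → ℝ} (hk : IntegrableOn k (Ioi 0)) :
    Tendsto (fun x => ∫ t in Ioi x, k t) (𝓝[>] 0) (𝓝 (∫ t in Ioi 0, k t)) := by
  have h1 : IntervalIntegrable k volume 0 1 :=
    (intervalIntegrable_iff_integrableOn_Ioc_of_le zero_le_one).2
      (hk.mono_set Ioc_subset_Ioi_self)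
  have h2 := (tendsto_const_nhds (x := ∫ t in Ioi 0, k t)).sub
    (tendsto_intervalIntegral_zero_right h1)
  rw [sub_zero] at h2
  refine h2.congr' ?_
  filter_upwards [self_mem_nhdsWithin] with x hx
  rw [← intervalIntegral.integral_Ioi_sub_Ioi hk (le_of_lt hx)]; ring

omit K in
lemma tendsto_integral_Ioi_atTop {k : ℝ → ℝ} (hk : IntegrableOn k (Ioi 0)) :
    Tendsto (fun x => ∫ t in Ioi x, k t) atTop (𝓝 0) := by
  have h1 := intervalIntegral_tendsto_integral_Ioi 0 hk tendsto_id
  have h2 := (tendsto_const_nhds (x := ∫ t in Ioi 0, k t)).sub h1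
  rw [sub_self] at h2
  refine h2.congr' ?_
  filter_upwards [eventually_ge_atTop 0] with x hx
  rw [id, ← intervalIntegral.integral_Ioi_sub_Ioi hk hx]; ring

lemma intB_zero : Tendsto (fun x => ∫ t in Ioi x, t ^ (r - 1) * B t) (𝓝[>] 0)
    (𝓝 (∫ t in Ioi 0, t ^ (r - 1) * B t)) := tendsto_integral_Ioi_zero_right K.B_int

lemma intA_nonneg {x : ℝ} (hx : 0 < x) : 0 ≤ ∫ t in (0 : ℝ)..x, t ^ (r - 1) * A t :=
  intervalIntegral.integral_nonneg_of_ae_restrict hx.le (by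
    filter_upwards [ae_restrict_mem measurableSet_Icc,
      ae_restrict_of_ae (measure_eq_zero_iff_ae_notMem.1 (Real.volume_singleton (a := 0)))]
      with t ht h0
    have ht0 : 0 < t := lt_of_le_of_ne ht.1 (Ne.symm h0)
    exact mul_nonneg (Real.rpow_nonneg ht.1 _) (K.A_pos t ht0).le)

/-- Monotonicity of `A` bounds the integral by `A x * (x ^ r / r)`, and `A b ≤ 1` by the Wronskian
relation. -/
lemma b_mul_intA_le {x : ℝ} (hx : 0 < x) :
    b x * (∫ t in (0 : ℝ)..x, t ^ (r - 1) * A t) ≤ x ^ r / r := by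
  have hr := K.r_pos
  have h1 : (∫ t in (0 : ℝ)..x, t ^ (r - 1) * A t) ≤ A x * (x ^ r / r) := by
    refine le_of_tendsto_zero_right hx (K.intA_zero.const_sub _ |>.congr' (.of_forall fun _ => rfl)
      |> fun h => by simpa using h) ((((tendsto_rpow_zero_right hr).div_const r).const_sub
      (x ^ r / r)).const_mul (A x) |> fun h => by simpa using h) fun y hy hyx => ?_
    · have := K.intA_prim.sub_le_sub ((isPrimitive_rpow r).const_mul (A x / r)) hy hyx
        fun t ht => by
          have ht0 := hy.trans_le ht.1
          have h0 := Real.rpow_pos_of_pos ht0 (r - 1)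
          calc t ^ (r - 1) * A t ≤ t ^ (r - 1) * A x := by
                gcongr; exact K.A_mono ht0 ht.2
            _ = A x / r * (r * t ^ (r - 1)) := by field_simp
      calc _ ≤ _ := this
        _ = _ := by field_simp
  have h2 : A x * b x ≤ 1 := by
    nlinarith [K.wronskian x hx, mul_nonneg (K.a_nonneg x hx) (K.B_pos x hx).le]
  have h3 : 0 ≤ x ^ r / r := by positivity
  calc _ ≤ b x * (A x * (x ^ r / r)) := mul_le_mul_of_nonneg_left h1 (K.b_nonneg x hx)
    _ = (A x * b x) * (x ^ r / r) := by ring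
    _ ≤ 1 * (x ^ r / r) := by gcongr
    _ = _ := one_mul _

/-- Both sides are compared with `a b / (lam x)`. Since `b x = lam ∫ₓ^∞ t ^ r B` and `a x = lam ∫₀ˣ
t ^ r A`, it is enough to replace `t ^ r` by `x t ^ (r - 1)`, which is smaller for `t ≥ x` and
larger for `t ≤ x`. -/
lemma a_mul_intB_le {x : ℝ} (hx : 0 < x) :
    a x * (∫ t in Ioi x, t ^ (r - 1) * B t) ≤
      b x * (∫ t in (0 : ℝ)..x, t ^ (r - 1) * A t) := by
  have hl := K.lam_pos
  have h1 : (∫ t in Ioi x, t ^ (r - 1) * B t) ≤ b x / (lam * x) := by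
    refine le_of_tendsto_of_tendsto ((tendsto_integral_Ioi_atTop K.B_int).const_sub _ |>
      fun h => by simpa using h) ((K.b_infty.const_sub (b x)).div_const (lam * x) |>
      fun h => by simpa using h) ?_
    filter_upwards [eventually_ge_atTop x] with y hy
    have := K.intB_prim.neg.sub_le_sub (K.b_prim.const_mul (-1 / (lam * x))) hx hy fun t ht => by
      have ht0 := hx.trans_le ht.1
      rw [neg_neg, ← rpow_sub_one_mul_self (r := r) ht0]
      have h0 := Real.rpow_pos_of_pos ht0 (r - 1)
      have hB := K.B_pos t ht0
      have : -1 / (lam * x) * -(lam * (t ^ (r - 1) * t) * B t) =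
          (t ^ (r - 1) * B t) * (t / x) := by field_simp
      rw [this]
      exact le_mul_of_one_le_right (by positivity) ((one_le_div hx).2 ht.1)
    calc _ = _ := by ring
      _ ≤ _ := this
      _ = _ := by ring
  have h2 : a x / (lam * x) ≤ ∫ t in (0 : ℝ)..x, t ^ (r - 1) * A t := by
    refine le_of_tendsto_zero_right hx ((K.a_zero.const_sub (a x)).div_const (lam * x) |>
      fun h => by simpa using h) (K.intA_zero.const_sub _ |> fun h => by simpa using h)
      fun y hy hyx => ?_
    have := (K.a_prim.const_mul (1 / (lam * x))).sub_le_sub K.intA_prim hy hyx fun t ht => by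
      have ht0 := hy.trans_le ht.1
      rw [← rpow_sub_one_mul_self ht0]
      have h0 := Real.rpow_pos_of_pos ht0 (r - 1)
      have hA := K.A_pos t ht0
      have : 1 / (lam * x) * (lam * (t ^ (r - 1) * t) * A t) =
          (t ^ (r - 1) * A t) * (t / x) := by field_simp
      rw [this]
      exact mul_le_of_le_one_right (by positivity) ((div_le_one hx).2 ht.2)
    calc _ = _ := by ring
      _ ≤ _ := this
  have ha := K.a_nonneg x hx
  have hb := K.b_nonneg x hx
  calc _ ≤ a x * (b x / (lam * x)) := by gcongr
    _ = b x * (a x / (lam * x)) := by ring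
    _ ≤ _ := by gcongr

/-- `B ∫₀ˣ t ^ (r - 1) A → 0` at the origin. -/
lemma B_mul_intA_zero : Tendsto (fun x => B x * ∫ t in (0 : ℝ)..x, t ^ (r - 1) * A t)
    (𝓝[>] 0) (𝓝 0) := by
  have h1 := K.A_zero.mul ((tendsto_const_nhds (x := ∫ t in Ioi 0, t ^ (r - 1) * B t)).sub
    K.intB_zero)
  rw [sub_self, mul_zero] at h1
  refine squeeze_zero' ?_ ?_ h1
  · filter_upwards [self_mem_nhdsWithin] with x hx
    exact mul_nonneg (K.B_pos x hx).le (K.intA_nonneg hx)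
  -- For `t ≤ x` one has `B x * A t ≤ B t * A x`, so the quantity is at most `A x` times the
  -- integral of `t ^ (r - 1) B` over `(0, x)`.
  · filter_upwards [self_mem_nhdsWithin] with x hx
    have hx : 0 < x := hx
    refine le_of_tendsto_zero_right hx ((K.intA_zero.const_sub _).const_mul (B x) |>
      fun h => by simpa using h) ((K.intB_zero.sub_const _).const_mul (A x)) fun y hy hyx => ?_
    have := (K.intA_prim.const_mul (B x)).sub_le_sub (K.intB_prim.const_mul (-A x)) hy hyx
      fun t ht => by
        have ht0 := hy.trans_le ht.1
        have h0 := Real.rpow_pos_of_pos ht0 (r - 1)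
        have hA := K.A_pos t ht0
        have hB := K.B_pos x hx
        calc B x * (t ^ (r - 1) * A t) = t ^ (r - 1) * (B x * A t) := by ring
          _ ≤ t ^ (r - 1) * (B t * A x) := by
            have hB' := K.B_pos t ht0
            gcongr
            · exact K.B_anti ht0 ht.2
            · exact K.A_mono ht0 ht.2
          _ = _ := by ring
    calc _ = _ := by ring
      _ ≤ _ := this
      _ = _ := by ring

/-- The left side has derivative `(a ∫ₓ^∞ t ^ (r - 1) B - b ∫₀ˣ t ^ (r - 1) A) / x ^ r`, the
Wronskian-free terms cancelling; this is nonpositive by `a_mul_intB_le`, so the value at `x` is at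
most the limit at `0`. -/
lemma potential_le {x : ℝ} (hx : 0 < x) :
    A x * (∫ t in Ioi x, t ^ (r - 1) * B t) + B x * (∫ t in (0 : ℝ)..x, t ^ (r - 1) * A t) ≤
      A₀ * ∫ t in Ioi 0, t ^ (r - 1) * B t := by
  have hlim := (K.A_zero.mul K.intB_zero).add K.B_mul_intA_zero
  rw [add_zero] at hlim
  refine le_of_tendsto_zero_right hx tendsto_const_nhds hlim fun y hy hyx => ?_
  have h := (((K.A_prim.mul K.intB_prim).add (K.B_prim.mul K.intA_prim)).sub_le_sub
    ((isPrimitive_rpow 0).const_mul 0) hy hyx fun t ht => by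
      have ht0 := hy.trans_le ht.1
      have h0 := Real.rpow_pos_of_pos ht0 r
      have := div_le_div_of_nonneg_right (K.a_mul_intB_le ht0) h0.le
      simp only [zero_mul, mul_zero]
      have e1 : a t / t ^ r * (∫ s in Ioi t, s ^ (r - 1) * B s) =
        a t * (∫ s in Ioi t, s ^ (r - 1) * B s) / t ^ r := by ring
      have e2 : -(b t / t ^ r) * (∫ s in (0 : ℝ)..t, s ^ (r - 1) * A s) =
        -(b t * (∫ s in (0 : ℝ)..t, s ^ (r - 1) * A s) / t ^ r) := by ring
      rw [e1, e2]
      linarith)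
  linarith

end SteinKernel

end Kernel

/-! ### Bounded solutions on the half line: a priori bounds, differentiation, existence. -/

section HalfSolutions
open Set Filter Topology

namespace HalfSol

variable {r lam : ℝ} {g u v : ℝ → ℝ}

lemma congr {g' u' v' : ℝ → ℝ} (hs : HalfSol r lam g u v) (hg : ∀ x, 0 < x → g x = g' x)
    (hu : ∀ x, 0 < x → u x = u' x) (hv : ∀ x, 0 < x → v x = v' x) : HalfSol r lam g' u' v' where
  deriv x hx := by
    rw [← hv x hx]
    refine (hs.deriv x hx).congr_of_eventuallyEq ?_
    filter_upwards [Ioi_mem_nhds hx] with y hy using (hu y hy).symm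
  prim := hs.prim.congr (fun x hx => by rw [hv x hx]) (fun x hx => by rw [hu x hx, hg x hx])
  bdd := by
    obtain ⟨C, hC⟩ := hs.bdd
    exact ⟨C, fun x hx => hu x hx ▸ hC x hx⟩
  zero := hs.zero.congr' (by filter_upwards [self_mem_nhdsWithin] with x hx using by rw [hv x hx])

lemma neg (hs : HalfSol r lam g u v) :
    HalfSol r lam (fun x => -g x) (fun x => -u x) (fun x => -v x) where
  deriv x hx := (hs.deriv x hx).neg
  prim := hs.prim.neg.congr (fun _ _ => by ring) (fun _ _ => by ring)
  bdd := by
    obtain ⟨C, hC⟩ := hs.bdd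
    exact ⟨C, fun x hx => by rw [abs_neg]; exact hC x hx⟩
  zero := by simpa using hs.zero.neg

lemma continuousOn_deriv (hs : HalfSol r lam g u v) : ContinuousOn v (Ioi 0) := by
  have h := hs.prim.continuousOn.div (continuousOn_rpow_Ioi r)
    fun x hx => (Real.rpow_pos_of_pos hx r).ne'
  refine h.congr fun x hx => ?_
  have := Real.rpow_pos_of_pos hx r
  simp only [Pi.div_apply]
  field_simp

lemma continuousOn (hs : HalfSol r lam g u v) : ContinuousOn u (Ioi 0) :=
  continuousOn_Ioi_of_hasDerivAt hs.deriv

lemma isPrimitive (hs : HalfSol r lam g u v) : IsPrimitive u v :=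
  .of_hasDerivAt hs.deriv hs.continuousOn_deriv

/-- Quotient rule for `v = (x ^ r v) / x ^ r`: second derivatives exist wherever the integrated
equation can be differentiated. -/
lemma hasDerivAt_deriv_of {x : ℝ} (hx : 0 < x)
    (h : HasDerivAt (fun x => x ^ r * v x) (lam * x ^ (r - 1) * (x * u x + g x)) x) :
    HasDerivAt v (lam * (x * u x + g x) / x - r * v x / x) x := by
  have h0 := Real.rpow_pos_of_pos hx r
  have h1 := h.div (Real.hasDerivAt_rpow_const (p := r) (Or.inl hx.ne')) h0.ne'
  have h2 : v =ᶠ[𝓝 x] (fun x => x ^ r * v x) / fun x => x ^ r := by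
    filter_upwards [Ioi_mem_nhds hx] with y hy
    have := Real.rpow_pos_of_pos hy r
    simp only [Pi.div_apply]
    field_simp
  refine (h1.congr_of_eventuallyEq h2).congr_deriv ?_
  rw [Real.rpow_sub_one hx.ne']
  field_simp

lemma hasDerivAt_deriv (hs : HalfSol r lam g u v) {x : ℝ} (hx : 0 < x) (hg : ContinuousAt g x) :
    HasDerivAt v (lam * (x * u x + g x) / x - r * v x / x) x := by
  refine hasDerivAt_deriv_of hx (hs.prim.hasDerivAt hx ?_)
  exact (continuousAt_const.mul (Real.continuousAt_rpow_const _ _ (Or.inl hx.ne'))).mul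
    ((continuousAt_id.mul (hs.deriv x hx).continuousAt).add hg)

lemma ae_hasDerivAt_deriv (hs : HalfSol r lam g u v) :
    ∀ᵐ x, 0 < x → HasDerivAt v (lam * (x * u x + g x) / x - r * v x / x) x := by
  filter_upwards [hs.prim.ae_hasDerivAt] with x hx hx0 using hasDerivAt_deriv_of hx0 (hx hx0)

/-- The a priori bounds for bounded solutions on the half line. -/
theorem bounds {A B a b : ℝ → ℝ} {A₀ M : ℝ} (hs : HalfSol r lam g u v)
    (K : SteinKernel r lam A B a b A₀) (hg : ∀ x, 0 < x → |g x| ≤ M) {x : ℝ} (hx : 0 < x) :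
    |u x| ≤ lam * M * (A₀ * ∫ t in Ioi 0, t ^ (r - 1) * B t) ∧ |v x| ≤ 2 * lam * M / r := by
  have hr := K.r_pos
  have hl := K.lam_pos
  have hM : 0 ≤ M := (abs_nonneg _).trans (hg 1 one_pos)
  obtain ⟨C, hC⟩ := hs.bdd
  have hC0 : 0 ≤ C := (abs_nonneg _).trans (hC 1 one_pos)
  have hX : IsPrimitive (fun t => t ^ r * v t * A t - u t * a t)
      (fun t => lam * g t * (t ^ (r - 1) * A t)) :=
    ((hs.prim.mul K.A_prim).sub (hs.isPrimitive.mul K.a_prim)).congr (fun _ _ => rfl)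
      fun t ht => by
        have h0 := Real.rpow_pos_of_pos ht (r - 1)
        rw [← rpow_sub_one_mul_self (r := r) ht]
        field_simp
        ring
  have hY : IsPrimitive (fun t => t ^ r * v t * B t + u t * b t)
      (fun t => lam * g t * (t ^ (r - 1) * B t)) :=
    ((hs.prim.mul K.B_prim).add (hs.isPrimitive.mul K.b_prim)).congr (fun _ _ => rfl)
      fun t ht => by
        have h0 := Real.rpow_pos_of_pos ht (r - 1)
        rw [← rpow_sub_one_mul_self (r := r) ht]
        field_simp
        ring
  have hX0 : Tendsto (fun t => t ^ r * v t * A t - u t * a t) (𝓝[>] 0) (𝓝 0) := by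
    have h1 := hs.zero.mul K.A_zero
    have h2 : Tendsto (fun t => u t * a t) (𝓝[>] 0) (𝓝 0) := by
      refine squeeze_zero_norm' (a := fun t => C * |a t|) ?_
        (by simpa using K.a_zero.abs.const_mul C)
      filter_upwards [self_mem_nhdsWithin] with t ht
      rw [norm_mul]
      exact mul_le_mul_of_nonneg_right (hC t ht) (abs_nonneg _)
    simpa using h1.sub h2
  -- Crude growth bound, from integrating the equation over `[1, y]`; the decay `x ^ (r + 1) * B x →
  -- 0` then kills the boundary term at infinity.
  have hw : ∀ y, 1 ≤ y → |y ^ r * v y| ≤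
      (|v 1| + lam * C / (r + 1) + lam * M / r) * y ^ (r + 1) := fun y hy => by
    have hP : IsPrimitive (fun t => lam * C / (r + 1) * t ^ (r + 1) + lam * M / r * t ^ r)
        (fun t => lam * C * t ^ r + lam * M * t ^ (r - 1)) :=
      (((isPrimitive_rpow (r + 1)).const_mul (lam * C / (r + 1))).add
        ((isPrimitive_rpow r).const_mul (lam * M / r))).congr (fun _ _ => rfl) fun t ht => by
          rw [add_sub_cancel_right]
          field_simp
    have h1 := hs.prim.abs_sub_le hP one_pos hy fun t ht => by
      have ht0 : 0 < t := one_pos.trans_le ht.1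
      have h0 := Real.rpow_pos_of_pos ht0 (r - 1)
      rw [abs_mul, abs_of_pos (by positivity : 0 < lam * t ^ (r - 1))]
      have h3 : |t * u t + g t| ≤ t * C + M := by
        refine (abs_add_le _ _).trans ?_
        rw [abs_mul, abs_of_pos ht0]
        exact add_le_add (mul_le_mul_of_nonneg_left (hC t ht0) ht0.le) (hg t ht0)
      calc _ ≤ lam * t ^ (r - 1) * (t * C + M) := by gcongr
        _ = _ := by rw [← rpow_sub_one_mul_self (r := r) ht0]; ring
    simp only [Real.one_rpow, one_mul, mul_one] at h1
    have h2 : y ^ r ≤ y ^ (r + 1) := Real.rpow_le_rpow_of_exponent_le hy (by linarith)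
    have h3 : 1 ≤ y ^ (r + 1) := Real.one_le_rpow hy (by linarith)
    have h4 := abs_sub_abs_le_abs_sub (y ^ r * v y) (v 1)
    have h5 : lam * M / r * y ^ r ≤ lam * M / r * y ^ (r + 1) := by gcongr
    have h6 : |v 1| ≤ |v 1| * y ^ (r + 1) := le_mul_of_one_le_right (abs_nonneg _) h3
    have h7 : 0 ≤ lam * C / (r + 1) := by positivity
    have h8 : 0 ≤ lam * M / r := by positivity
    linarith
  have hYinf : Tendsto (fun t => t ^ r * v t * B t + u t * b t) atTop (𝓝 0) := by
    have h1 : Tendsto (fun t => t ^ r * v t * B t) atTop (𝓝 0) := by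
      refine squeeze_zero_norm' ?_ (by
        simpa using K.B_infty.const_mul (|v 1| + lam * C / (r + 1) + lam * M / r))
      filter_upwards [eventually_ge_atTop 1] with t ht
      have hB := K.B_pos t (one_pos.trans_le ht)
      rw [norm_mul, Real.norm_of_nonneg hB.le, ← mul_assoc]
      exact mul_le_mul_of_nonneg_right (hw t ht) hB.le
    have h2 : Tendsto (fun t => u t * b t) atTop (𝓝 0) := by
      refine squeeze_zero_norm' (a := fun t => C * |b t|) ?_
        (by simpa using K.b_infty.abs.const_mul C)
      filter_upwards [eventually_gt_atTop 0] with t ht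
      rw [norm_mul]
      exact mul_le_mul_of_nonneg_right (hC t ht) (abs_nonneg _)
    simpa using h1.add h2
  have hXx : |x ^ r * v x * A x - u x * a x| ≤
      lam * M * ∫ t in (0 : ℝ)..x, t ^ (r - 1) * A t := by
    refine le_of_tendsto_zero_right hx (hX0.const_sub _ |>.abs |> fun h => by simpa using h)
      ((K.intA_zero.const_sub _).const_mul (lam * M) |> fun h => by simpa using h)
      fun y hy hyx => ?_
    refine (hX.abs_sub_le (K.intA_prim.const_mul (lam * M)) hy hyx fun t ht => ?_).trans_eq
      (by ring)
    have ht0 := hy.trans_le ht.1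
    have h0 := mul_pos (Real.rpow_pos_of_pos ht0 (r - 1)) (K.A_pos t ht0)
    rw [abs_mul, abs_of_pos h0, abs_mul, abs_of_pos hl]
    have := hg t ht0
    gcongr
  have hYx : |x ^ r * v x * B x + u x * b x| ≤
      lam * M * ∫ t in Ioi x, t ^ (r - 1) * B t := by
    refine le_of_tendsto_of_tendsto (hYinf.sub_const _ |>.abs |> fun h => by
        simpa only [zero_sub, abs_neg] using h)
      (((SteinKernel.tendsto_integral_Ioi_atTop K.B_int).const_sub _).const_mul (lam * M) |>
        fun h => by simpa using h) ?_
    filter_upwards [eventually_ge_atTop x] with y hy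
    refine (hY.abs_sub_le (K.intB_prim.const_mul (-(lam * M))) hx hy fun t ht => ?_).trans_eq
      (by ring)
    have ht0 := hx.trans_le ht.1
    have h0 := mul_pos (Real.rpow_pos_of_pos ht0 (r - 1)) (K.B_pos t ht0)
    rw [abs_mul, abs_of_pos h0, abs_mul, abs_of_pos hl, neg_mul_neg]
    have := hg t ht0
    gcongr
  have hW := K.wronskian x hx
  have hA := K.A_pos x hx
  have hB := K.B_pos x hx
  have ha := K.a_nonneg x hx
  have hb := K.b_nonneg x hx
  constructor
  -- Cramer's rule: the Wronskian relation inverts the linear map from `(u, x ^ r v)` to the two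
  -- combinations just bounded.
  · have e : u x = A x * (x ^ r * v x * B x + u x * b x) -
        B x * (x ^ r * v x * A x - u x * a x) := by linear_combination -u x * hW
    calc |u x| ≤ |A x * (x ^ r * v x * B x + u x * b x)| +
          |B x * (x ^ r * v x * A x - u x * a x)| := by
            nth_rw 1 [e]; exact abs_sub _ _
      _ = A x * |x ^ r * v x * B x + u x * b x| + B x * |x ^ r * v x * A x - u x * a x| := by
            rw [abs_mul, abs_mul, abs_of_pos hA, abs_of_pos hB]
      _ ≤ A x * (lam * M * ∫ t in Ioi x, t ^ (r - 1) * B t) +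
          B x * (lam * M * ∫ t in (0 : ℝ)..x, t ^ (r - 1) * A t) := by gcongr
      _ = lam * M * (A x * (∫ t in Ioi x, t ^ (r - 1) * B t) +
          B x * ∫ t in (0 : ℝ)..x, t ^ (r - 1) * A t) := by ring
      _ ≤ _ := by gcongr; exact K.potential_le hx
  · have h0 := Real.rpow_pos_of_pos hx r
    have e : x ^ r * v x = a x * (x ^ r * v x * B x + u x * b x) +
        b x * (x ^ r * v x * A x - u x * a x) := by linear_combination -(x ^ r * v x) * hW
    have h1 : x ^ r * |v x| ≤ lam * M * (2 * (x ^ r / r)) := by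
      calc x ^ r * |v x| = |x ^ r * v x| := by rw [abs_mul, abs_of_pos h0]
        _ ≤ |a x * (x ^ r * v x * B x + u x * b x)| +
            |b x * (x ^ r * v x * A x - u x * a x)| := by
              nth_rw 1 [e]; exact abs_add_le _ _
        _ = a x * |x ^ r * v x * B x + u x * b x| + b x * |x ^ r * v x * A x - u x * a x| := by
              rw [abs_mul, abs_mul, abs_of_nonneg ha, abs_of_nonneg hb]
        _ ≤ a x * (lam * M * ∫ t in Ioi x, t ^ (r - 1) * B t) +
            b x * (lam * M * ∫ t in (0 : ℝ)..x, t ^ (r - 1) * A t) := by gcongr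
        _ = lam * M * (a x * (∫ t in Ioi x, t ^ (r - 1) * B t) +
            b x * ∫ t in (0 : ℝ)..x, t ^ (r - 1) * A t) := by ring
        _ ≤ _ := by
            gcongr
            linarith [K.b_mul_intA_le hx, K.a_mul_intB_le hx]
    rw [← mul_le_mul_iff_right₀ h0]
    calc _ ≤ _ := h1
      _ = _ := by field_simp

/-- The derivative of a solution solves the equation with `r + 1`. -/
theorem derivative {g₁ : ℝ → ℝ} (hs : HalfSol r lam g u v) (hr : 0 < r)
    (hg : IsPrimitive g g₁) {M : ℝ} (hM : ∀ x, 0 < x → |g x| ≤ M)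
    (hv : ∃ C, ∀ x, 0 < x → |v x| ≤ C) :
    HalfSol (r + 1) lam (fun x => g₁ x + u x) v
      (fun x => lam * (x * u x + g x) / x - r * v x / x) := by
  -- Solving the equation for `x ^ (r + 1) v'` expresses it through `u`, `g` and `x ^ r v`, which
  -- are all primitives; both the new integrated equation and its boundary value at `0` are read off
  -- from this.
  have e : ∀ x : ℝ, 0 < x → lam * (x ^ (r + 1) * u x) + lam * (x ^ r * g x) - r * (x ^ r * v x) =
      x ^ (r + 1) * (lam * (x * u x + g x) / x - r * v x / x) := fun x hx => by
    rw [Real.rpow_add_one hx.ne']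
    field_simp
  refine ⟨fun x hx => hs.hasDerivAt_deriv hx
    (hg.continuousOn.continuousAt (Ioi_mem_nhds hx)), ?_, hv, ?_⟩
  · refine (((((isPrimitive_rpow (r + 1)).mul hs.isPrimitive).const_mul lam).add
      (((isPrimitive_rpow r).mul hg).const_mul lam)).sub (hs.prim.const_mul r)).congr e
      fun t ht => ?_
    rw [add_sub_cancel_right, Real.rpow_add_one ht.ne', ← rpow_sub_one_mul_self (r := r) ht]
    ring
  · obtain ⟨C, hC⟩ := hs.bdd
    have h1 : Tendsto (fun x => x ^ (r + 1) * u x) (𝓝[>] 0) (𝓝 0) := by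
      refine squeeze_zero_norm' (a := fun t => t ^ (r + 1) * C) ?_
        (by simpa using (tendsto_rpow_zero_right (by linarith : 0 < r + 1)).mul_const C)
      filter_upwards [self_mem_nhdsWithin] with t ht
      have h0 := Real.rpow_pos_of_pos ht (r + 1)
      rw [norm_mul, Real.norm_of_nonneg h0.le]
      exact mul_le_mul_of_nonneg_left (hC t ht) h0.le
    have h2 : Tendsto (fun x => x ^ r * g x) (𝓝[>] 0) (𝓝 0) := by
      refine squeeze_zero_norm' (a := fun t => t ^ r * M) ?_
        (by simpa using (tendsto_rpow_zero_right hr).mul_const M)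
      filter_upwards [self_mem_nhdsWithin] with t ht
      have h0 := Real.rpow_pos_of_pos ht r
      rw [norm_mul, Real.norm_of_nonneg h0.le]
      exact mul_le_mul_of_nonneg_left (hM t ht) h0.le
    have h3 := ((h1.const_mul lam).add (h2.const_mul lam)).sub (hs.zero.const_mul r)
    simp only [mul_zero, add_zero, sub_zero] at h3
    exact h3.congr' (by filter_upwards [self_mem_nhdsWithin] with x hx using e x hx)

/-- The derivative at the origin is determined by the equation. -/
theorem tendsto_deriv_zero (hs : HalfSol r lam g u v) (hr : 0 < r) (hl : 0 < lam) {L : ℝ}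
    (hg : Tendsto g (𝓝[>] 0) (𝓝 L)) : Tendsto v (𝓝[>] 0) (𝓝 (lam * L / r)) := by
  obtain ⟨C, hC⟩ := hs.bdd
  have hu : Tendsto (fun t => t * u t) (𝓝[>] 0) (𝓝 0) := by
    refine squeeze_zero_norm' (a := fun t => t * C) ?_ ?_
    · filter_upwards [self_mem_nhdsWithin] with t ht
      have ht : 0 < t := ht
      rw [norm_mul, Real.norm_of_nonneg ht.le]
      exact mul_le_mul_of_nonneg_left (hC t ht) ht.le
    · have : Tendsto (fun t : ℝ => t * C) (𝓝 0) (𝓝 (0 * C)) := tendsto_id.mul_const C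
      rw [zero_mul] at this
      exact this.mono_left nhdsWithin_le_nhds
  have hsum := hu.add hg
  rw [zero_add] at hsum
  -- Subtracting the explicit primitive of `lam * L * t ^ (r - 1)` leaves an integrand that is small
  -- relative to `t ^ (r - 1)` near `0`.
  have hP : IsPrimitive (fun t => t ^ r * v t - lam * L / r * t ^ r)
      (fun t => lam * t ^ (r - 1) * (t * u t + g t - L)) :=
    (hs.prim.sub ((isPrimitive_rpow r).const_mul (lam * L / r))).congr (fun _ _ => rfl)
      fun t ht => by field_simp
  have hP0 : Tendsto (fun t => t ^ r * v t - lam * L / r * t ^ r) (𝓝[>] 0) (𝓝 0) := by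
    simpa using hs.zero.sub ((tendsto_rpow_zero_right hr).const_mul (lam * L / r))
  rw [Metric.tendsto_nhds] at hsum ⊢
  intro ε hε
  -- This tolerance integrates against `lam * t ^ (r - 1)` to exactly `ε / 2 * x ^ r`.
  have hε' : 0 < ε * r / (2 * lam) := by positivity
  obtain ⟨δ, hδ, hd⟩ := mem_nhdsGT_iff_exists_Ioo_subset.1 (hsum _ hε')
  have hδ : 0 < δ := hδ
  filter_upwards [Ioo_mem_nhdsGT hδ] with x hx
  have h0 := Real.rpow_pos_of_pos hx.1 r
  have h1 : |x ^ r * v x - lam * L / r * x ^ r| ≤ ε / 2 * x ^ r := by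
    refine le_of_tendsto_zero_right hx.1 (hP0.const_sub _ |>.abs |> fun h => by simpa using h)
      (((tendsto_rpow_zero_right hr).const_sub _).const_mul (ε / 2) |>
        fun h => by simpa using h) fun y hy hyx => ?_
    refine (hP.abs_sub_le ((isPrimitive_rpow r).const_mul (ε / 2)) hy hyx fun t ht => ?_).trans_eq
      (by ring)
    have ht0 := hy.trans_le ht.1
    have h0 := Real.rpow_pos_of_pos ht0 (r - 1)
    have h2 : |t * u t + g t - L| < ε * r / (2 * lam) := hd ⟨ht0, ht.2.trans_lt hx.2⟩
    rw [abs_mul, abs_of_pos (by positivity : 0 < lam * t ^ (r - 1))]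
    calc _ ≤ lam * t ^ (r - 1) * (ε * r / (2 * lam)) := by gcongr
      _ = _ := by field_simp
  rw [Real.dist_eq]
  have e : v x - lam * L / r = (x ^ r * v x - lam * L / r * x ^ r) / x ^ r := by field_simp
  rw [e, abs_div, abs_of_pos h0, div_lt_iff₀ h0]
  nlinarith

end HalfSol

namespace SteinKernel

variable {r lam A₀ : ℝ} {A B a b : ℝ → ℝ} (K : SteinKernel r lam A B a b A₀)
include K

lemma abs_intA_mul_le {g : ℝ → ℝ} {M : ℝ} (hg : Measurable g) (hM : ∀ x, 0 < x → |g x| ≤ M) {x : ℝ}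
    (hx : 0 < x) : |∫ t in (0 : ℝ)..x, t ^ (r - 1) * A t * g t| ≤
      M * ∫ t in (0 : ℝ)..x, t ^ (r - 1) * A t := by
  refine le_of_tendsto_zero_right hx
    ((tendsto_intervalIntegral_zero_right (K.intervalIntegrable_A hg hM one_pos)).const_sub _
      |>.abs |> fun h => by simpa using h)
    ((K.intA_zero.const_sub _).const_mul M |> fun h => by simpa using h) fun y hy hyx => ?_
  refine ((IsPrimitive.of_intervalIntegrable fun x hx =>
    K.intervalIntegrable_A hg hM hx).abs_sub_le (K.intA_prim.const_mul M) hy hyx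
      fun t ht => ?_).trans_eq (by ring)
  have ht0 := hy.trans_le ht.1
  have h0 := mul_pos (Real.rpow_pos_of_pos ht0 (r - 1)) (K.A_pos t ht0)
  rw [abs_mul, abs_of_pos h0, mul_comm]
  exact mul_le_mul_of_nonneg_right (hM t ht0) h0.le

lemma abs_intB_mul_le {g : ℝ → ℝ} {M : ℝ} (hM : ∀ x, 0 < x → |g x| ≤ M) {x : ℝ}
    (hx : 0 < x) : |∫ t in Ioi x, t ^ (r - 1) * B t * g t| ≤
      M * ∫ t in Ioi x, t ^ (r - 1) * B t := by
  rw [← integral_const_mul, ← Real.norm_eq_abs]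
  refine norm_integral_le_of_norm_le ((K.B_int.mono_set (Ioi_subset_Ioi hx.le)).const_mul M) ?_
  filter_upwards [ae_restrict_mem measurableSet_Ioi] with t ht
  have ht0 : 0 < t := hx.trans ht
  have h0 := mul_pos (Real.rpow_pos_of_pos ht0 (r - 1)) (K.B_pos t ht0)
  rw [norm_mul, Real.norm_of_nonneg h0.le, mul_comm]
  exact mul_le_mul_of_nonneg_right (hM t ht0) h0.le

/-- Variation of parameters solves the equation on the half line. -/
theorem halfSol {g : ℝ → ℝ} {M : ℝ} (hg : Measurable g) (hM : ∀ x, 0 < x → |g x| ≤ M) :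
    HalfSol r lam g
      (fun x => -lam * (B x * (∫ t in (0 : ℝ)..x, t ^ (r - 1) * A t * g t) +
        A x * ∫ t in Ioi x, t ^ (r - 1) * B t * g t))
      (fun x => lam * (b x * (∫ t in (0 : ℝ)..x, t ^ (r - 1) * A t * g t) -
        a x * ∫ t in Ioi x, t ^ (r - 1) * B t * g t) / x ^ r) := by
  have hr := K.r_pos
  have hl := K.lam_pos
  have hM0 : 0 ≤ M := (abs_nonneg _).trans (hM 1 one_pos)
  have hG1 := IsPrimitive.of_intervalIntegrable fun x hx => K.intervalIntegrable_A hg hM hx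
  have hG2 := IsPrimitive.of_integrableOn_Ioi (K.integrableOn_B hg hM)
  have hw := ((K.b_prim.mul hG1).sub (K.a_prim.mul hG2)).const_mul lam
  have hS := ((K.B_prim.mul hG1).add (K.A_prim.mul hG2)).const_mul (-lam)
  have hS' := hS.congr (fun _ _ => rfl) (l := fun x => lam * (b x *
      (∫ t in (0 : ℝ)..x, t ^ (r - 1) * A t * g t) -
        a x * ∫ t in Ioi x, t ^ (r - 1) * B t * g t) / x ^ r) fun t ht => by ring
  refine ⟨fun x hx => hS'.hasDerivAt hx ?_, ?_, ?_, ?_⟩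
  · refine (hw.continuousOn.div (continuousOn_rpow_Ioi r) fun x hx =>
      (Real.rpow_pos_of_pos hx r).ne').continuousAt (Ioi_mem_nhds hx)
  · refine hw.congr (fun x hx => ?_) (fun t ht => ?_)
    · have := Real.rpow_pos_of_pos hx r
      field_simp
    -- Variation of parameters: the boundary contributions of the two integrals add up to `g`
    -- through the Wronskian relation.
    · have h1 : g t = g t * (a t * B t + A t * b t) := by rw [K.wronskian t ht, mul_one]
      conv_rhs => rw [h1]
      rw [← rpow_sub_one_mul_self (r := r) ht]
      ring
  · refine ⟨lam * (M * (A₀ * ∫ t in Ioi 0, t ^ (r - 1) * B t)), fun x hx => ?_⟩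
    rw [abs_mul, abs_neg, abs_of_pos hl]
    have h1 := K.abs_intA_mul_le hg hM hx
    have h2 := K.abs_intB_mul_le hM hx
    have hA := K.A_pos x hx
    have hB := K.B_pos x hx
    refine mul_le_mul_of_nonneg_left ?_ hl.le
    calc _ ≤ _ := abs_add_le _ _
      _ ≤ B x * (M * ∫ t in (0 : ℝ)..x, t ^ (r - 1) * A t) +
          A x * (M * ∫ t in Ioi x, t ^ (r - 1) * B t) := by
        rw [abs_mul, abs_mul, abs_of_pos hA, abs_of_pos hB]
        gcongr
      _ = M * (A x * (∫ t in Ioi x, t ^ (r - 1) * B t) +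
          B x * ∫ t in (0 : ℝ)..x, t ^ (r - 1) * A t) := by ring
      _ ≤ _ := by gcongr; exact K.potential_le hx
  · refine squeeze_zero_norm' (a := fun x => lam * (M * (2 * (x ^ r / r)))) ?_
      (by simpa using ((((tendsto_rpow_zero_right hr).div_const r).const_mul 2).const_mul
        M).const_mul lam)
    filter_upwards [self_mem_nhdsWithin] with x hx
    have hx : 0 < x := hx
    have h0 := Real.rpow_pos_of_pos hx r
    rw [mul_div_cancel₀ _ h0.ne', norm_mul, Real.norm_of_nonneg hl.le]
    have h1 := K.abs_intA_mul_le hg hM hx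
    have h2 := K.abs_intB_mul_le hM hx
    have ha := K.a_nonneg x hx
    have hb := K.b_nonneg x hx
    refine mul_le_mul_of_nonneg_left ?_ hl.le
    calc _ ≤ _ := abs_sub _ _
      _ ≤ b x * (M * ∫ t in (0 : ℝ)..x, t ^ (r - 1) * A t) +
          a x * (M * ∫ t in Ioi x, t ^ (r - 1) * B t) := by
        rw [abs_mul, abs_mul, abs_of_nonneg ha, abs_of_nonneg hb]
        gcongr
      _ = M * (a x * (∫ t in Ioi x, t ^ (r - 1) * B t) +
          b x * ∫ t in (0 : ℝ)..x, t ^ (r - 1) * A t) := by ring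
      _ ≤ _ := by
        gcongr
        linarith [K.b_mul_intA_le hx, K.a_mul_intB_le hx]

/-- The limit at the origin of the solution given by variation of parameters. -/
theorem tendsto_solution_zero {g : ℝ → ℝ} {M : ℝ} (hg : Measurable g)
    (hM : ∀ x, 0 < x → |g x| ≤ M) :
    Tendsto (fun x => -lam * (B x * (∫ t in (0 : ℝ)..x, t ^ (r - 1) * A t * g t) +
        A x * ∫ t in Ioi x, t ^ (r - 1) * B t * g t)) (𝓝[>] 0)
      (𝓝 (-lam * (A₀ * ∫ t in Ioi 0, t ^ (r - 1) * B t * g t))) := by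
  have h1 : Tendsto (fun x => B x * ∫ t in (0 : ℝ)..x, t ^ (r - 1) * A t * g t) (𝓝[>] 0)
      (𝓝 0) := by
    refine squeeze_zero_norm' ?_ (by simpa using K.B_mul_intA_zero.const_mul M)
    filter_upwards [self_mem_nhdsWithin] with x hx
    have hB := K.B_pos x hx
    rw [norm_mul, Real.norm_of_nonneg hB.le]
    calc _ ≤ B x * (M * ∫ t in (0 : ℝ)..x, t ^ (r - 1) * A t) :=
          mul_le_mul_of_nonneg_left (K.abs_intA_mul_le hg hM hx) hB.le
      _ = _ := by ring
  have h2 := K.A_zero.mul (tendsto_integral_Ioi_zero_right (K.integrableOn_B hg hM))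
  simpa using (h1.add h2).const_mul (-lam)

end SteinKernel

end HalfSolutions

/-! ### The function `K_ν` through a gamma-type integral. -/

section BesselK
open Set Filter Topology

/-- `Q_a(y) = ∫₀^∞ exp (-s - y² / (4 s)) s ^ (a - 1) ds = 2 (y / 2) ^ a K_a(y)`. -/
noncomputable def besselQ (a y : ℝ) : ℝ :=
  ∫ s in Ioi (0 : ℝ), Real.exp (-s - y ^ 2 / (4 * s)) * s ^ (a - 1)

lemma besselQ_measurable (a y : ℝ) :
    Measurable (fun s : ℝ => Real.exp (-s - y ^ 2 / (4 * s)) * s ^ (a - 1)) := by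
  fun_prop

/-- From `exp z ≥ z ^ n / n!`: the Gaussian-type factor is traded for `s ^ n`, so a Gamma integrand
with parameter `a + n` dominates. Large `n` covers every real `a`, and the factor `y ^ (-2n)` gives
the decay at infinity. -/
lemma besselQ_integrand_le {a y s : ℝ} (n : ℕ) (hy : 0 < y) (hs : 0 < s) :
    Real.exp (-s - y ^ 2 / (4 * s)) * s ^ (a - 1) ≤
      n ! * (4 / y ^ 2) ^ n * (Real.exp (-s) * s ^ (a + n - 1)) := by
  have h1 : (y ^ 2 / (4 * s)) ^ n / n ! ≤ Real.exp (y ^ 2 / (4 * s)) :=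
    Real.pow_div_factorial_le_exp _ (by positivity) n
  have h2 : Real.exp (-(y ^ 2 / (4 * s))) ≤ n ! * (4 / y ^ 2) ^ n * s ^ n := by
    rw [Real.exp_neg]
    refine (inv_anti₀ (by positivity) h1).trans_eq ?_
    rw [inv_div, div_pow, div_pow, mul_pow]
    field_simp
  have h3 : s ^ (a + n - 1) = s ^ n * s ^ (a - 1) := by
    rw [← Real.rpow_natCast, ← Real.rpow_add hs]; congr 1; ring
  rw [h3, sub_eq_add_neg, Real.exp_add]
  have h4 := Real.rpow_pos_of_pos hs (a - 1)
  calc _ ≤ Real.exp (-s) * (n ! * (4 / y ^ 2) ^ n * s ^ n) * s ^ (a - 1) := by gcongr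
    _ = _ := by ring

lemma besselQ_integrable (a : ℝ) {y : ℝ} (hy : 0 < y) :
    IntegrableOn (fun s : ℝ => Real.exp (-s - y ^ 2 / (4 * s)) * s ^ (a - 1)) (Ioi 0) := by
  obtain ⟨n, hn⟩ := exists_nat_gt (-a)
  refine Integrable.mono' ((Real.GammaIntegral_convergent (s := a + n) (by linarith)).const_mul
    (n ! * (4 / y ^ 2) ^ n)) (besselQ_measurable a y).aestronglyMeasurable ?_
  filter_upwards [ae_restrict_mem measurableSet_Ioi] with s hs
  have hs : 0 < s := hs
  rw [Real.norm_of_nonneg (by positivity)]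
  exact besselQ_integrand_le n hy hs

lemma besselQ_le (a : ℝ) {y : ℝ} (n : ℕ) (hn : 0 < a + n) (hy : 0 < y) :
    besselQ a y ≤ n ! * (4 / y ^ 2) ^ n * Real.Gamma (a + n) := by
  rw [Real.Gamma_eq_integral hn, ← integral_const_mul]
  exact setIntegral_mono_on (besselQ_integrable a hy)
    ((Real.GammaIntegral_convergent hn).const_mul _) measurableSet_Ioi
    fun s hs => besselQ_integrand_le n hy hs

lemma besselQ_pos (a : ℝ) {y : ℝ} (hy : 0 < y) : 0 < besselQ a y := by
  refine (setIntegral_pos_iff_support_of_nonneg_ae ?_ (besselQ_integrable a hy)).2 ?_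
  · filter_upwards [ae_restrict_mem measurableSet_Ioi] with s hs
    have hs : 0 < s := hs
    simp only [Pi.zero_apply]
    positivity
  · have : Function.support (fun s : ℝ => Real.exp (-s - y ^ 2 / (4 * s)) * s ^ (a - 1)) ∩ Ioi 0
        = Ioi 0 := by
      refine inter_eq_right.2 fun s hs => ?_
      have hs : 0 < s := hs
      exact (mul_pos (Real.exp_pos _) (Real.rpow_pos_of_pos hs _)).ne'
    rw [this]; simp

lemma besselQ_anti (a : ℝ) {y z : ℝ} (hy : 0 < y) (hyz : y ≤ z) : besselQ a z ≤ besselQ a y :=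
  setIntegral_mono_on (besselQ_integrable a (hy.trans_le hyz)) (besselQ_integrable a hy)
    measurableSet_Ioi fun s hs => by
      have hs : 0 < s := hs
      gcongr

lemma besselQ_hasDerivAt (a : ℝ) {y : ℝ} (hy : 0 < y) :
    HasDerivAt (besselQ a) (-(y / 2) * besselQ (a - 1) y) y := by
  have hpow : ∀ s : ℝ, 0 < s → s ^ (a - 1) / s = s ^ (a - 1 - 1) := fun s hs =>
    (Real.rpow_sub_one hs.ne' _).symm
  have h := hasDerivAt_integral_of_dominated_loc_of_deriv_le (μ := volume.restrict (Ioi 0))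
    (F := fun y s => Real.exp (-s - y ^ 2 / (4 * s)) * s ^ (a - 1)) (x₀ := y)
    (F' := fun y s => -(y / 2) * (Real.exp (-s - y ^ 2 / (4 * s)) * s ^ (a - 1 - 1)))
    (bound := fun s => y * (Real.exp (-s - (y / 2) ^ 2 / (4 * s)) * s ^ (a - 1 - 1)))
    -- On this neighbourhood `z / 2 ≤ y` and `z ≥ y / 2`, which yields an integrable bound uniform
    -- in `z`.
    (s := Ioo (y / 2) (2 * y)) (Ioo_mem_nhds (by linarith) (by linarith))
    (.of_forall fun z => (besselQ_measurable a z).aestronglyMeasurable)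
    (besselQ_integrable a hy)
    (((besselQ_measurable (a - 1) y).const_mul _).aestronglyMeasurable)
    (by
      filter_upwards [ae_restrict_mem measurableSet_Ioi] with s hs z hz
      have hs : 0 < s := hs
      have hz0 : 0 < z := by linarith [hz.1]
      have h0 := Real.rpow_pos_of_pos hs (a - 1 - 1)
      rw [neg_mul, norm_neg, Real.norm_of_nonneg (by positivity)]
      have h1 : z / 2 ≤ y := by linarith [hz.2]
      have h2 : y / 2 ≤ z := hz.1.le
      gcongr)
    ((besselQ_integrable (a - 1) (by positivity)).const_mul y)
    (by
      filter_upwards [ae_restrict_mem measurableSet_Ioi] with s hs z hz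
      have hs : 0 < s := hs
      have h1 : HasDerivAt (fun z : ℝ => -s - z ^ 2 / (4 * s)) (-(2 * z / (4 * s))) z := by
        simpa using ((hasDerivAt_pow 2 z).div_const (4 * s)).const_sub (-s)
      refine (h1.exp.mul_const (s ^ (a - 1))).congr_deriv ?_
      rw [← hpow s hs]
      field_simp
      norm_num)
  refine h.2.congr_deriv ?_
  rw [integral_const_mul]; rfl

lemma besselQ_tendsto_zero {a : ℝ} (ha : 0 < a) :
    Tendsto (besselQ a) (𝓝[>] 0) (𝓝 (Real.Gamma a)) := by
  rw [Real.Gamma_eq_integral ha]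
  refine tendsto_integral_filter_of_dominated_convergence
    (fun s => Real.exp (-s) * s ^ (a - 1)) (.of_forall fun z =>
      (besselQ_measurable a z).aestronglyMeasurable) (.of_forall fun z => ?_)
      (Real.GammaIntegral_convergent ha) ?_
  · filter_upwards [ae_restrict_mem measurableSet_Ioi] with s hs
    have hs : 0 < s := hs
    rw [Real.norm_of_nonneg (by positivity)]
    gcongr
    have : 0 ≤ z ^ 2 / (4 * s) := by positivity
    linarith
  · refine .of_forall fun s => ?_
    have : Continuous fun z : ℝ => Real.exp (-s - z ^ 2 / (4 * s)) * s ^ (a - 1) := by fun_prop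
    have h := this.tendsto 0
    simp only [ne_eq, OfNat.ofNat_ne_zero, not_false_eq_true, zero_pow, zero_div, sub_zero] at h
    exact h.mono_left nhdsWithin_le_nhds

lemma besselQ_tendsto_atTop {a : ℝ} (n : ℕ) (ha : 0 < a + (n + 1 : ℕ)) :
    Tendsto (fun y => y ^ (2 * n) * besselQ a y) atTop (𝓝 0) := by
  have h1 : Tendsto (fun y : ℝ => (n + 1)! * 4 ^ (n + 1) * Real.Gamma (a + (n + 1 : ℕ)) / y ^ 2)
      atTop (𝓝 0) := tendsto_const_nhds.div_atTop (tendsto_pow_atTop two_ne_zero)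
  refine squeeze_zero' ?_ ?_ h1
  · filter_upwards [eventually_gt_atTop 0] with y hy
    exact mul_nonneg (by positivity) (besselQ_pos a hy).le
  · filter_upwards [eventually_gt_atTop 0] with y hy
    calc _ ≤ y ^ (2 * n) * _ := mul_le_mul_of_nonneg_left (besselQ_le a (n + 1) ha hy)
          (by positivity)
      _ = _ := by
        rw [div_pow, pow_mul, pow_succ (y ^ 2)]
        field_simp

/-- The total mass of `Q_a`. -/
lemma besselQ_integral {a : ℝ} (ha : 0 < a + 1 / 2) :
    IntegrableOn (besselQ a) (Ioi 0) ∧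
      ∫ y in Ioi 0, besselQ a y = √Real.pi * Real.Gamma (a + 1 / 2) := by
  have hG : ∀ s : ℝ, 0 < s → ∫ y in Ioi (0 : ℝ), Real.exp (-s - y ^ 2 / (4 * s)) * s ^ (a - 1) =
      √Real.pi * (Real.exp (-s) * s ^ (a + 1 / 2 - 1)) := fun s hs => by
    have h1 := integral_gaussian_Ioi (1 / (4 * s))
    have h2 : √(Real.pi / (1 / (4 * s))) / 2 = √Real.pi * √s := by
      rw [show Real.pi / (1 / (4 * s)) = 2 ^ 2 * (Real.pi * s) by field_simp; norm_num,
        Real.sqrt_mul (by norm_num), Real.sqrt_sq (by norm_num), Real.sqrt_mul Real.pi_pos.le]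
      ring
    have h3 : ∀ y : ℝ, Real.exp (-s - y ^ 2 / (4 * s)) * s ^ (a - 1) =
        Real.exp (-s) * s ^ (a - 1) * Real.exp (-(1 / (4 * s)) * y ^ 2) := fun y => by
      rw [show -s - y ^ 2 / (4 * s) = -s + -(1 / (4 * s)) * y ^ 2 by ring, Real.exp_add]
      ring
    simp_rw [h3]
    rw [integral_const_mul, h1, h2, Real.sqrt_eq_rpow s,
      show a + 1 / 2 - 1 = (a - 1) + 1 / 2 by ring, Real.rpow_add hs]
    ring
  have hm : AEStronglyMeasurable (fun p : ℝ × ℝ =>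
      Real.exp (-p.2 - p.1 ^ 2 / (4 * p.2)) * p.2 ^ (a - 1))
      ((volume.restrict (Ioi 0)).prod (volume.restrict (Ioi 0))) := by
    apply Measurable.aestronglyMeasurable; fun_prop
  have hI : Integrable (fun p : ℝ × ℝ =>
      Real.exp (-p.2 - p.1 ^ 2 / (4 * p.2)) * p.2 ^ (a - 1))
      ((volume.restrict (Ioi 0)).prod (volume.restrict (Ioi 0))) := by
    rw [integrable_prod_iff' hm]
    constructor
    · filter_upwards [ae_restrict_mem measurableSet_Ioi] with s hs
      have hs : 0 < s := hs
      -- A non-integrable function has integral `0` by convention, which contradicts the positive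
      -- value computed in `hG`.
      by_contra hc
      have h1 := hG s hs
      rw [integral_undef hc] at h1
      have h2 : 0 < √Real.pi * (Real.exp (-s) * s ^ (a + 1 / 2 - 1)) := by positivity
      linarith
    · refine ((Real.GammaIntegral_convergent ha).const_mul √Real.pi).congr ?_
      filter_upwards [ae_restrict_mem measurableSet_Ioi] with s hs
      have hs : 0 < s := hs
      rw [← hG s hs]
      refine integral_congr_ae (.of_forall fun y => ?_)
      simp only
      rw [Real.norm_of_nonneg (by positivity)]
  refine ⟨hI.integral_prod_left, ?_⟩
  have h := integral_integral_swap
    (f := fun y s : ℝ => Real.exp (-s - y ^ 2 / (4 * s)) * s ^ (a - 1)) hI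
  unfold besselQ
  rw [h, Real.Gamma_eq_integral ha, ← integral_const_mul]
  exact setIntegral_congr_fun measurableSet_Ioi fun s hs => hG s hs

/-- `besselQ a` is decreasing, so its value at `y` times the length `y` is at most its total mass.
This controls the possible blow-up at `0` when `a ≤ 0`. -/
lemma mul_besselQ_le {a y : ℝ} (ha : 0 < a + 1 / 2) (hy : 0 < y) :
    y * besselQ a y ≤ √Real.pi * Real.Gamma (a + 1 / 2) := by
  obtain ⟨hi, he⟩ := besselQ_integral ha
  rw [← he]
  calc y * besselQ a y = ∫ _ in Ioc 0 y, besselQ a y := by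
        simp [hy.le]
    _ ≤ ∫ z in Ioc 0 y, besselQ a z :=
      setIntegral_mono_on (by simp) (hi.mono_set Ioc_subset_Ioi_self) measurableSet_Ioc
        fun z hz => besselQ_anti a hz.1 hz.2
    _ ≤ _ := setIntegral_mono_set hi (by
        filter_upwards [ae_restrict_mem measurableSet_Ioi] with z hz using (besselQ_pos a hz).le)
        (LE.le.eventuallyLE Ioc_subset_Ioi_self)

/-- The modified Bessel function of the second kind as a gamma-type integral. -/
lemma besselK_eq_besselQ (ν : ℝ) {x : ℝ} (hx : 0 < x) :
    besselK ν x = 1 / 2 * (x / 2) ^ (-ν) * besselQ ν x := by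
  -- Substitution `s = (x / 2) exp t`, which turns `s + x ^ 2 / (4 * s)` into `x * cosh t`.
  have hx2 : 0 < x / 2 := by positivity
  have him : (fun t => x / 2 * Real.exp t) '' univ = Ioi 0 := by
    ext s
    simp only [image_univ, mem_range, mem_Ioi]
    refine ⟨fun ⟨t, ht⟩ => ht ▸ by positivity, fun hs => ⟨Real.log (s / (x / 2)), ?_⟩⟩
    rw [Real.exp_log (by positivity)]; field_simp
  have hd : ∀ t ∈ (univ : Set ℝ), HasDerivWithinAt (fun t => x / 2 * Real.exp t)
      (x / 2 * Real.exp t) univ t := fun t _ => ((Real.hasDerivAt_exp t).const_mul _).hasDerivWithinAt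
  have hinj : InjOn (fun t => x / 2 * Real.exp t) univ := fun s _ t _ h =>
    Real.exp_injective (mul_left_cancel₀ hx2.ne' h)
  have hfun : ∀ t : ℝ, |x / 2 * Real.exp t| • (Real.exp (-(x / 2 * Real.exp t) -
      x ^ 2 / (4 * (x / 2 * Real.exp t))) * (x / 2 * Real.exp t) ^ (ν - 1)) =
      (x / 2) ^ ν * (Real.exp (-x * Real.cosh t) * Real.exp (ν * t)) := fun t => by
    have he := Real.exp_pos t
    rw [abs_of_pos (by positivity), smul_eq_mul, Real.rpow_sub_one (by positivity),
      Real.mul_rpow hx2.le he.le, ← Real.exp_mul, Real.cosh_eq, Real.exp_neg,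
      show -(x / 2 * Real.exp t) - x ^ 2 / (4 * (x / 2 * Real.exp t)) =
        -x * ((Real.exp t + (Real.exp t)⁻¹) / 2) by field_simp; ring, mul_comm t ν]
    field_simp
  have h1 := integral_image_eq_integral_abs_deriv_smul MeasurableSet.univ hd hinj
    (fun s => Real.exp (-s - x ^ 2 / (4 * s)) * s ^ (ν - 1))
  have h2 := integrableOn_image_iff_integrableOn_abs_deriv_smul MeasurableSet.univ hd hinj
    (fun s => Real.exp (-s - x ^ 2 / (4 * s)) * s ^ (ν - 1))
  simp_rw [hfun] at h1 h2
  rw [him] at h1 h2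
  have hpow : 0 < (x / 2) ^ ν := by positivity
  have h3 : Integrable fun t => Real.exp (-x * Real.cosh t) * Real.exp (ν * t) := by
    have := (h2.1 (besselQ_integrable ν hx))
    rw [integrableOn_univ] at this
    simpa [hpow.ne'] using this.const_mul ((x / 2) ^ ν)⁻¹
  have h4 : besselQ ν x = (x / 2) ^ ν *
      ∫ t, Real.exp (-x * Real.cosh t) * Real.exp (ν * t) := by
    rw [besselQ, h1, setIntegral_univ, integral_const_mul]
  -- Folding the line at `0`: `cosh t` is even, and `exp (ν t) + exp (-ν t) = 2 cosh (ν t)`.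
  have h5 : ∫ t, Real.exp (-x * Real.cosh t) * Real.exp (ν * t) = 2 * besselK ν x := by
    have e1 : ∫ t in Iic (0 : ℝ), Real.exp (-x * Real.cosh t) * Real.exp (ν * t) =
        ∫ t in Ioi (0 : ℝ), Real.exp (-x * Real.cosh t) * Real.exp (-(ν * t)) := by
      have := integral_comp_neg_Ioi (0 : ℝ)
        (fun t => Real.exp (-x * Real.cosh t) * Real.exp (ν * t))
      rw [neg_zero] at this
      rw [← this]
      simp
    have i1 : IntegrableOn (fun t => Real.exp (-x * Real.cosh t) * Real.exp (-(ν * t)))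
        (Ioi (0 : ℝ)) := by
      have := h3.comp_neg.integrableOn (s := Ioi 0)
      simpa using this
    rw [← intervalIntegral.integral_Iic_add_Ioi (b := 0) h3.integrableOn h3.integrableOn, e1,
      ← integral_add i1 h3.integrableOn, besselK, ← integral_const_mul]
    refine integral_congr_ae (.of_forall fun t => ?_)
    simp only [Real.cosh_eq (ν * t)]
    ring
  rw [h4, h5, Real.rpow_neg hx2.le]
  field_simp

lemma besselK_neg (ν x : ℝ) : besselK (-ν) x = besselK ν x := by
  simp [besselK]

end BesselK

/-! ### The function `I_ν` through an entire power series. -/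

section BesselI
open Set Filter Topology

/-- The entire function `P_ν(z) = ∑ z ^ k / (k! Γ(ν + k + 1))`, with
`I_ν(x) = (x / 2) ^ ν P_ν(x² / 4)`. -/
noncomputable def besselP (ν z : ℝ) : ℝ :=
  ∑' k : ℕ, z ^ k / (k ! * Real.Gamma (ν + k + 1))

/-- From `k = 1` on, `Γ(s + 1) = s Γ(s)` with `s ≥ 1` makes the sequence nondecreasing. The index `k
= 0` is separate because the factor `ν + 1` may be less than `1`. -/
lemma exists_le_Gamma {ν : ℝ} (hν : -1 < ν) :
    ∃ C, 0 < C ∧ ∀ k : ℕ, C ≤ Real.Gamma (ν + k + 1) := by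
  refine ⟨min (Real.Gamma (ν + 1)) (Real.Gamma (ν + 1 + 1)),
    lt_min (Real.Gamma_pos_of_pos (by linarith)) (Real.Gamma_pos_of_pos (by linarith)), ?_⟩
  have h : ∀ k : ℕ, Real.Gamma (ν + 1 + 1) ≤ Real.Gamma (ν + (k + 1 : ℕ) + 1) := fun k => by
    induction k with
    | zero => simp
    | succ k ih =>
      refine ih.trans ?_
      have h1 : 0 < ν + (k + 1 : ℕ) + 1 := by push_cast; linarith [(Nat.cast_nonneg k : (0:ℝ) ≤ k)]
      rw [show ν + (k + 1 + 1 : ℕ) + 1 = (ν + (k + 1 : ℕ) + 1) + 1 by push_cast; ring,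
        Real.Gamma_add_one h1.ne']
      refine le_mul_of_one_le_left (Real.Gamma_pos_of_pos h1).le ?_
      push_cast; linarith [(Nat.cast_nonneg k : (0:ℝ) ≤ k)]
  rintro (_ | k)
  · simp
  · exact (min_le_right _ _).trans (h k)

lemma besselP_term_le {ν C : ℝ} (hC : 0 < C) (h : ∀ k : ℕ, C ≤ Real.Gamma (ν + k + 1)) (z : ℝ)
    (k : ℕ) : |z ^ k / (k ! * Real.Gamma (ν + k + 1))| ≤ |z| ^ k / k ! * C⁻¹ := by
  have h1 := hC.trans_le (h k)
  have h2 : (0 : ℝ) < k ! := by positivity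
  rw [abs_div, abs_mul, abs_of_pos h1, abs_of_pos h2, abs_pow, ← div_div, div_eq_mul_inv _ (Real.Gamma _)]
  gcongr
  exact h k

lemma besselP_summable {ν : ℝ} (hν : -1 < ν) (z : ℝ) :
    Summable fun k : ℕ => z ^ k / (k ! * Real.Gamma (ν + k + 1)) := by
  obtain ⟨C, hC, h⟩ := exists_le_Gamma hν
  exact .of_norm_bounded ((Real.summable_pow_div_factorial |z|).mul_right C⁻¹)
    (besselP_term_le hC h z)

lemma besselP_pos {ν z : ℝ} (hν : -1 < ν) (hz : 0 ≤ z) : 0 < besselP ν z := by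
  have h0 : ∀ k : ℕ, 0 < Real.Gamma (ν + k + 1) := fun k =>
    Real.Gamma_pos_of_pos (by linarith [(Nat.cast_nonneg k : (0:ℝ) ≤ k)])
  refine (besselP_summable hν z).tsum_pos (fun k => ?_) 0 ?_
  · have := h0 k
    positivity
  · have := h0 0
    simp at this ⊢
    positivity

lemma besselP_zero (ν : ℝ) : besselP ν 0 = 1 / Real.Gamma (ν + 1) := by
  rw [besselP, tsum_eq_single 0 fun k hk => by simp [hk]]
  simp

lemma besselP_deriv_term (ν z : ℝ) (k : ℕ) :
    ((k + 1 : ℕ) : ℝ) * z ^ (k + 1 - 1) / ((k + 1)! * Real.Gamma (ν + (k + 1 : ℕ) + 1)) =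
      z ^ k / (k ! * Real.Gamma (ν + 1 + k + 1)) := by
  rw [Nat.factorial_succ, add_tsub_cancel_right]
  have h : (0 : ℝ) < k ! := by positivity
  rw [show ν + (k + 1 : ℕ) + 1 = ν + 1 + k + 1 by push_cast; ring]
  push_cast
  rw [mul_assoc, mul_div_mul_left _ _ (by positivity)]

lemma besselP_hasSum_deriv {ν : ℝ} (hν : -1 < ν) (z : ℝ) :
    HasSum (fun k : ℕ => (k : ℝ) * z ^ (k - 1) / (k ! * Real.Gamma (ν + k + 1)))
      (besselP (ν + 1) z) := by
  have h := (besselP_summable (by linarith : -1 < ν + 1) z).hasSum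
  rw [← hasSum_nat_add_iff' 1]
  simp only [Finset.range_one, Finset.sum_singleton, Nat.cast_zero, zero_mul, zero_div, sub_zero]
  simp_rw [besselP_deriv_term]
  exact h

lemma besselP_hasDerivAt {ν : ℝ} (hν : -1 < ν) (z : ℝ) :
    HasDerivAt (besselP ν) (besselP (ν + 1) z) z := by
  rw [← (besselP_hasSum_deriv hν z).tsum_eq]
  have hb : Summable fun k : ℕ =>
      |(k : ℝ) * (|z| + 1) ^ (k - 1) / (k ! * Real.Gamma (ν + k + 1))| :=
    (besselP_hasSum_deriv hν (|z| + 1)).summable.abs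
  refine hasDerivAt_tsum_of_isPreconnected (t := Metric.ball 0 (|z| + 1))
    (g := fun (k : ℕ) z => z ^ k / (k ! * Real.Gamma (ν + k + 1))) hb Metric.isOpen_ball
    (convex_ball _ _).isPreconnected (fun k y _ => (hasDerivAt_pow k y).div_const _)
    (fun k y hy => ?_) (y₀ := z) ?_ (besselP_summable hν z) ?_
  · have hy : |y| < |z| + 1 := by simpa using hy
    rw [norm_div, norm_mul, norm_pow, abs_div, abs_mul, abs_pow, Real.norm_eq_abs, Real.norm_eq_abs,
      Real.norm_eq_abs]
    have : |y| ≤ |(|z| + 1)| := hy.le.trans (le_abs_self _)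
    gcongr
  · simp
  · simp

/-- In `Γ(ν + k + 2) = (ν + k + 1) Γ(ν + k + 1)` split the factor as `(ν + 1) + k`; the `k` part is
`z` times the differentiated series. This is Bessel's equation in first-order form. -/
lemma besselP_recurrence {ν : ℝ} (hν : -1 < ν) (z : ℝ) :
    besselP ν z = (ν + 1) * besselP (ν + 1) z + z * besselP (ν + 1 + 1) z := by
  have hν' : -1 < ν + 1 := by linarith
  have h := ((besselP_summable hν' z).hasSum.mul_left (ν + 1)).add
    ((besselP_hasSum_deriv hν' z).mul_left z)
  refine HasSum.tsum_eq ?_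
  refine h.congr_fun fun k => ?_
  have h1 : 0 < ν + k + 1 := by linarith [(Nat.cast_nonneg k : (0:ℝ) ≤ k)]
  rw [show ν + 1 + k + 1 = (ν + k + 1) + 1 by ring, Real.Gamma_add_one h1.ne']
  have h2 := Real.Gamma_pos_of_pos h1
  have h3 : (0 : ℝ) < k ! := by positivity
  rcases k with _ | k
  · simp at h1 h2 ⊢
    field_simp
  · rw [add_tsub_cancel_right, pow_succ]
    field_simp
    push_cast
    ring

lemma besselI_eq_besselP (ν : ℝ) {x : ℝ} (hx : 0 < x) :
    besselI ν x = (x / 2) ^ ν * besselP ν (x ^ 2 / 4) := by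
  rw [besselI, besselP, ← tsum_mul_left]
  refine tsum_congr fun k => ?_
  rw [Real.rpow_add (by positivity), show (2 * (k : ℝ)) = ((2 * k : ℕ) : ℝ) by push_cast; ring,
    Real.rpow_natCast, pow_mul, div_pow x 2 2]
  norm_num
  ring

end BesselI

/-! ### The variance-gamma fundamental system. -/

section VGKernel
open Set Filter Topology

/-- `|x| ^ (-ν) I_ν(|x| / σ)`. -/
noncomputable def vgKernelA (ν σ x : ℝ) : ℝ := (2 * σ) ^ (-ν) * besselP ν (x ^ 2 / (4 * σ ^ 2))

/-- `|x| ^ (-ν) K_ν(|x| / σ)`. -/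
noncomputable def vgKernelB (ν σ x : ℝ) : ℝ := 1 / 2 * (2 * σ) ^ (-ν) * besselQ (-ν) (x / σ)

lemma rpow_mul_besselI {ν σ x : ℝ} (hσ : 0 < σ) (hx : 0 < x) :
    x ^ ν * besselI ν (x / σ) = x ^ (2 * ν) * vgKernelA ν σ x := by
  rw [besselI_eq_besselP ν (by positivity), vgKernelA, two_mul, Real.rpow_add hx,
    Real.rpow_neg (by positivity), div_div, mul_comm σ 2, Real.div_rpow hx.le (by positivity),
    div_pow, div_div, mul_comm (σ ^ 2)]
  field_simp

lemma besselI_div {ν σ x : ℝ} (hσ : 0 < σ) (hx : 0 < x) :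
    besselI ν (x / σ) = x ^ ν * vgKernelA ν σ x := by
  have h1 := rpow_mul_besselI (ν := ν) hσ hx
  rw [two_mul, Real.rpow_add hx, mul_assoc] at h1
  exact mul_left_cancel₀ (Real.rpow_pos_of_pos hx ν).ne' h1

lemma besselK_div {ν σ x : ℝ} (hσ : 0 < σ) (hx : 0 < x) :
    besselK ν (x / σ) = x ^ ν * vgKernelB ν σ x := by
  rw [← besselK_neg, besselK_eq_besselQ (-ν) (by positivity), vgKernelB, neg_neg, div_div,
    mul_comm σ 2, Real.div_rpow hx.le (by positivity), Real.rpow_neg (by positivity)]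
  field_simp

/-- The symmetry `K_{-ν} = K_ν` gives `x ^ (-ν) K_ν` in terms of `besselQ (-ν)` and `x ^ ν K_ν` in
terms of `besselQ ν`; the second form is the weight whose integral is known. -/
lemma rpow_mul_vgKernelB {ν σ x : ℝ} (hσ : 0 < σ) (hx : 0 < x) :
    x ^ (2 * ν) * vgKernelB ν σ x = 1 / 2 * (2 * σ) ^ ν * besselQ ν (x / σ) := by
  have h := besselK_div (ν := ν) hσ hx
  rw [besselK_eq_besselQ ν (by positivity), div_div, mul_comm σ 2,
    Real.div_rpow hx.le (by positivity), Real.rpow_neg hx.le, Real.rpow_neg (by positivity)] at h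
  have h1 := Real.rpow_pos_of_pos hx ν
  rw [two_mul, Real.rpow_add hx, mul_assoc, ← h]
  field_simp

lemma besselQ_neg (a : ℝ) {y : ℝ} (hy : 0 < y) :
    besselQ (-a) y = (y / 2) ^ (-(2 * a)) * besselQ a y := by
  have h := besselK_neg a y
  rw [besselK_eq_besselQ _ hy, besselK_eq_besselQ _ hy, neg_neg] at h
  have h1 : (0 : ℝ) < (y / 2) ^ a := by positivity
  rw [show -(2 * a) = -a + -a by ring, Real.rpow_add (by positivity)]
  rw [Real.rpow_neg (by positivity)] at h ⊢
  field_simp at h ⊢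
  linarith

/-- The derivative formulas come from `P_ν' = P_{ν+1}` and `Q_a'(y) = -(y / 2) Q_{a-1}(y)`. The
relation `r = 2 ν + 1` is what makes the power `x ^ r` the right weight. -/
theorem vgKernel {r ν σ : ℝ} (hr : 0 < r) (hσ : 0 < σ) (hν : r = 2 * ν + 1) :
    SteinKernel r (1 / σ ^ 2) (vgKernelA ν σ) (vgKernelB ν σ)
      (fun x => (2 * σ) ^ (-ν) * (1 / (2 * σ ^ 2)) * x ^ (r + 1) *
        besselP (ν + 1) (x ^ 2 / (4 * σ ^ 2)))
      (fun x => (2 * σ) ^ ν * besselQ (ν + 1) (x / σ))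
      ((2 * σ) ^ (-ν) * (1 / Real.Gamma (ν + 1))) := by
  have hν0 : -1 / 2 < ν := by linarith
  have hν1 : -1 < ν := by linarith
  have hc : 0 < (2 * σ) ^ (-ν) := by positivity
  have hc' : 0 < (2 * σ) ^ ν := by positivity
  have hV : ∀ x, 0 < x → x ^ (r - 1) * vgKernelB ν σ x =
      1 / 2 * (2 * σ) ^ ν * besselQ ν (x / σ) := fun x hx => by
    rw [show r - 1 = 2 * ν by linarith, rpow_mul_vgKernelB hσ hx]
  have hz : ∀ x : ℝ, HasDerivAt (fun x : ℝ => x ^ 2 / (4 * σ ^ 2)) (x / (2 * σ ^ 2)) x := fun x => by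
    refine ((hasDerivAt_pow 2 x).div_const (4 * σ ^ 2)).congr_deriv ?_
    field_simp
    ring
  have hP : ∀ {μ : ℝ}, -1 < μ → ∀ x : ℝ, HasDerivAt (fun x => besselP μ (x ^ 2 / (4 * σ ^ 2)))
      (besselP (μ + 1) (x ^ 2 / (4 * σ ^ 2)) * (x / (2 * σ ^ 2))) x := fun hμ x =>
    (besselP_hasDerivAt hμ _).comp x (hz x)
  have hPpos : ∀ {μ : ℝ}, -1 < μ → ∀ x : ℝ, 0 < besselP μ (x ^ 2 / (4 * σ ^ 2)) :=
    fun hμ x => besselP_pos hμ (by positivity)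
  have hQ : ∀ (μ x : ℝ), 0 < x → HasDerivAt (fun x => besselQ μ (x / σ))
      (-(x / σ / 2) * besselQ (μ - 1) (x / σ) * (1 / σ)) x := fun μ x hx =>
    (besselQ_hasDerivAt μ (by positivity)).comp x ((hasDerivAt_id x).div_const σ)
  have hA0 : Tendsto (vgKernelA ν σ) (𝓝[>] 0) (𝓝 ((2 * σ) ^ (-ν) * (1 / Real.Gamma (ν + 1)))) := by
    have h := ((hP hν1 0).continuousAt.const_mul ((2 * σ) ^ (-ν))).tendsto
    simp only [ne_eq, OfNat.ofNat_ne_zero, not_false_eq_true, zero_pow, zero_div,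
      besselP_zero] at h
    exact h.mono_left nhdsWithin_le_nhds
  have ha0 : Tendsto (fun x => (2 * σ) ^ (-ν) * (1 / (2 * σ ^ 2)) * x ^ (r + 1) *
        besselP (ν + 1) (x ^ 2 / (4 * σ ^ 2))) (𝓝[>] 0) (𝓝 0) := by
    have h := ((hP (by linarith : -1 < ν + 1) 0).continuousAt.tendsto).mono_left
      (nhdsWithin_le_nhds (s := Ioi 0))
    have h2 := ((tendsto_rpow_zero_right (by linarith : 0 < r + 1)).const_mul
      ((2 * σ) ^ (-ν) * (1 / (2 * σ ^ 2)))).mul h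
    rwa [mul_zero, zero_mul] at h2
  have hdiv : Tendsto (fun x : ℝ => x / σ) (𝓝[>] 0) (𝓝[>] 0) := by
    refine tendsto_nhdsWithin_iff.2 ⟨?_, ?_⟩
    · have : Tendsto (fun x : ℝ => x / σ) (𝓝 0) (𝓝 (0 / σ)) := tendsto_id.div_const σ
      rw [zero_div] at this
      exact this.mono_left nhdsWithin_le_nhds
    · filter_upwards [self_mem_nhdsWithin] with x hx using div_pos hx hσ
  have hdiv' : Tendsto (fun x : ℝ => x / σ) atTop atTop := tendsto_id.atTop_div_const hσ
  have hA_deriv : ∀ x, 0 < x → HasDerivAt (vgKernelA ν σ) ((2 * σ) ^ (-ν) * (1 / (2 * σ ^ 2)) *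
      x ^ (r + 1) * besselP (ν + 1) (x ^ 2 / (4 * σ ^ 2)) / x ^ r) x := fun x hx => by
    refine ((hP hν1 x).const_mul ((2 * σ) ^ (-ν))).congr_deriv ?_
    have := Real.rpow_pos_of_pos hx r
    rw [Real.rpow_add_one hx.ne']
    field_simp
  have ha_deriv : ∀ x, 0 < x → HasDerivAt (fun x => (2 * σ) ^ (-ν) * (1 / (2 * σ ^ 2)) *
      x ^ (r + 1) * besselP (ν + 1) (x ^ 2 / (4 * σ ^ 2)))
      (1 / σ ^ 2 * x ^ r * vgKernelA ν σ x) x := fun x hx => by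
    refine (((Real.hasDerivAt_rpow_const (p := r + 1) (Or.inl hx.ne')).const_mul
      ((2 * σ) ^ (-ν) * (1 / (2 * σ ^ 2)))).mul (hP (by linarith : -1 < ν + 1) x)).congr_deriv ?_
    rw [vgKernelA, besselP_recurrence hν1, Real.rpow_add_one hx.ne', add_sub_cancel_right, hν]
    field_simp
    ring
  have hB_deriv : ∀ x, 0 < x → HasDerivAt (vgKernelB ν σ)
      (-((2 * σ) ^ ν * besselQ (ν + 1) (x / σ) / x ^ r)) x := fun x hx => by
    refine ((hQ (-ν) x hx).const_mul (1 / 2 * (2 * σ) ^ (-ν))).congr_deriv ?_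
    -- Differentiation lowers the index to `-ν - 1`; the reflection `besselQ_neg` brings it back to
    -- `ν + 1`.
    rw [show -ν - 1 = -(ν + 1) by ring, besselQ_neg _ (by positivity), div_div, mul_comm σ 2,
      show -(2 * (ν + 1)) = -(r + 1) by rw [hν]; ring, Real.rpow_neg (by positivity),
      Real.div_rpow hx.le (by positivity), Real.rpow_neg hx.le,
      Real.rpow_neg (by positivity : 0 ≤ 2 * σ), Real.rpow_add_one hx.ne',
      Real.rpow_add_one (by positivity)]
    have h1 := Real.rpow_pos_of_pos hx r
    have h2 : (2 * σ) ^ r = (2 * σ) ^ ν * (2 * σ) ^ ν * (2 * σ) := by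
      rw [← Real.rpow_add (by positivity), ← Real.rpow_add_one (by positivity)]
      congr 1; linarith
    rw [h2]
    field_simp
  have hb_deriv : ∀ x, 0 < x → HasDerivAt (fun x => (2 * σ) ^ ν * besselQ (ν + 1) (x / σ))
      (-(1 / σ ^ 2 * x ^ r * vgKernelB ν σ x)) x := fun x hx => by
    refine ((hQ (ν + 1) x hx).const_mul ((2 * σ) ^ ν)).congr_deriv ?_
    have := hV x hx
    rw [← rpow_sub_one_mul_self (r := r) hx,
      show 1 / σ ^ 2 * (x ^ (r - 1) * x) * vgKernelB ν σ x =
        1 / σ ^ 2 * x * (x ^ (r - 1) * vgKernelB ν σ x) by ring, this, add_sub_cancel_right]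
    field_simp
  refine ⟨hr, by positivity, hA_deriv, ha_deriv, hB_deriv, hb_deriv, fun x _ => mul_pos hc (hPpos hν1 x),
    fun x hx => mul_pos (by positivity) (besselQ_pos _ (by positivity)), fun x hx => ?_,
    fun x hx => (mul_pos hc' (besselQ_pos _ (by positivity))).le, ?_, hA0, ha0, ?_, ?_, ?_⟩
  · have := hPpos (by linarith : -1 < ν + 1) x
    positivity
  · have hconst : ∀ x, 0 < x → HasDerivAt (fun x => (2 * σ) ^ (-ν) * (1 / (2 * σ ^ 2)) *
        x ^ (r + 1) * besselP (ν + 1) (x ^ 2 / (4 * σ ^ 2)) * vgKernelB ν σ x +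
        vgKernelA ν σ x * ((2 * σ) ^ ν * besselQ (ν + 1) (x / σ))) 0 x := fun x hx => by
      refine (((ha_deriv x hx).mul (hB_deriv x hx)).add
        ((hA_deriv x hx).mul (hb_deriv x hx))).congr_deriv ?_
      have h1 := Real.rpow_pos_of_pos hx r
      field_simp
      ring
    -- The Wronskian is constant, so its limit at `0` suffices: `a B → 0`, while in `A b` the two
    -- factors `Γ(ν + 1)` and the powers of `2 * σ` cancel.
    have hlim : Tendsto (fun x => (2 * σ) ^ (-ν) * (1 / (2 * σ ^ 2)) *
        x ^ (r + 1) * besselP (ν + 1) (x ^ 2 / (4 * σ ^ 2)) * vgKernelB ν σ x +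
        vgKernelA ν σ x * ((2 * σ) ^ ν * besselQ (ν + 1) (x / σ))) (𝓝[>] 0) (𝓝 1) := by
      have h1 := hA0.mul (((besselQ_tendsto_zero (by linarith : 0 < ν + 1)).comp hdiv).const_mul
        ((2 * σ) ^ ν))
      have hG := Real.Gamma_pos_of_pos (by linarith : 0 < ν + 1)
      rw [show (2 * σ) ^ (-ν) * (1 / Real.Gamma (ν + 1)) * ((2 * σ) ^ ν * Real.Gamma (ν + 1)) = 1 by
        rw [Real.rpow_neg (by positivity)]; field_simp] at h1
      -- This is `O(x)`: the product is `x ^ 2` times a multiple of `Q_ν(x / σ)`, and `y * Q_ν(y)`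
      -- is bounded.
      have hx2 : Tendsto (fun x => x ^ (r + 1) * vgKernelB ν σ x) (𝓝[>] 0) (𝓝 0) := by
        refine squeeze_zero' (g := fun x => 1 / 2 * (2 * σ) ^ ν * (σ * (√Real.pi *
          Real.Gamma (ν + 1 / 2))) * x) ?_ ?_ ?_
        · filter_upwards [self_mem_nhdsWithin] with x hx
          have hx : 0 < x := hx
          exact mul_nonneg (Real.rpow_nonneg hx.le _)
            (mul_pos (by positivity) (besselQ_pos _ (by positivity))).le
        · filter_upwards [self_mem_nhdsWithin] with x hx
          have hx : 0 < x := hx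
          have h2 := mul_besselQ_le (by linarith : 0 < ν + 1 / 2) (div_pos hx hσ)
          calc _ = x * x * (x ^ (r - 1) * vgKernelB ν σ x) := by
                rw [Real.rpow_add_one hx.ne', ← rpow_sub_one_mul_self (r := r) hx]; ring
            _ = 1 / 2 * (2 * σ) ^ ν * (σ * (x / σ * besselQ ν (x / σ))) * x := by
                rw [hV x hx]; field_simp
            _ ≤ _ := by gcongr
        · have : Tendsto (fun x : ℝ => 1 / 2 * (2 * σ) ^ ν * (σ * (√Real.pi *
            Real.Gamma (ν + 1 / 2))) * x) (𝓝 0) (𝓝 (1 / 2 * (2 * σ) ^ ν * (σ * (√Real.pi *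
            Real.Gamma (ν + 1 / 2))) * 0)) := tendsto_id.const_mul _
          rw [mul_zero] at this
          exact this.mono_left nhdsWithin_le_nhds
      have h3 := ((hP (by linarith : -1 < ν + 1) 0).continuousAt.tendsto).mono_left
        (nhdsWithin_le_nhds (s := Ioi 0))
      have h4 := ((h3.const_mul ((2 * σ) ^ (-ν) * (1 / (2 * σ ^ 2)))).mul hx2).add h1
      rw [mul_zero, zero_add] at h4
      refine h4.congr fun x => ?_
      simp only [Function.comp]
      ring
    intro x hx
    have hp := IsPrimitive.of_hasDerivAt hconst continuousOn_const
    refine tendsto_nhds_unique (tendsto_const_nhds.congr' ?_) hlim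
    filter_upwards [self_mem_nhdsWithin] with y hy
    have := (hp y x hy hx).2
    simp only [intervalIntegral.integral_zero] at this
    linarith
  · have h := (besselQ_tendsto_atTop (a := ν + 1) 0 (by push_cast; linarith)).comp hdiv'
    simpa [Function.comp_def] using h.const_mul ((2 * σ) ^ ν)
  · have h := ((besselQ_tendsto_atTop (a := ν) 1 (by push_cast; linarith)).comp hdiv').const_mul
      (1 / 2 * (2 * σ) ^ ν * σ ^ 2)
    rw [mul_zero] at h
    refine h.congr' ?_
    filter_upwards [eventually_gt_atTop 0] with x hx
    rw [Real.rpow_add_one hx.ne', ← rpow_sub_one_mul_self (r := r) hx]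
    have := hV x hx
    simp only [Function.comp]
    rw [show x ^ (r - 1) * x * x * vgKernelB ν σ x = x * x * (x ^ (r - 1) * vgKernelB ν σ x) by ring,
      this]
    field_simp
    rw [mul_one, div_pow]
    field_simp
  · have h1 : IntegrableOn (fun x => besselQ ν (x / σ)) (Ioi 0) := by
      have := (integrableOn_Ioi_comp_mul_left_iff (besselQ ν) 0 (inv_pos.2 hσ)).2
      simpa [div_eq_inv_mul] using this
        (by simpa using (besselQ_integral (by linarith : 0 < ν + 1 / 2)).1)
    have h2 : IntegrableOn (fun x => 1 / 2 * (2 * σ) ^ ν * besselQ ν (x / σ)) (Ioi 0) :=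
      h1.const_mul _
    exact h2.congr_fun (fun x hx => (hV x hx).symm)
      measurableSet_Ioi

lemma integral_vgKernelB {r ν σ : ℝ} (hr : 0 < r) (hσ : 0 < σ) (hν : r = 2 * ν + 1) :
    ∫ t in Ioi 0, t ^ (r - 1) * vgKernelB ν σ t =
      1 / 2 * (2 * σ) ^ ν * σ * (√Real.pi * Real.Gamma (r / 2)) := by
  have h := (besselQ_integral (a := ν) (by linarith)).2
  have h1 := integral_comp_mul_left_Ioi (besselQ ν) 0 (inv_pos.2 hσ)
  rw [mul_zero, h, inv_inv, smul_eq_mul, show ν + 1 / 2 = r / 2 by linarith] at h1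
  rw [setIntegral_congr_fun measurableSet_Ioi (g := fun t => 1 / 2 * (2 * σ) ^ ν *
    besselQ ν (σ⁻¹ * t)) fun t ht => ?_, integral_const_mul, h1]
  · ring
  · simp only
    rw [show r - 1 = 2 * ν by linarith, rpow_mul_vgKernelB hσ ht, div_eq_inv_mul t]

end VGKernel

/-! ### Gluing the two half lines at the origin. -/

section LineSolutions
open Set Filter Topology

/-- `F` is an indefinite integral of the locally integrable function `k` on the line. -/
def IsLinePrimitive (F k : ℝ → ℝ) : Prop :=
  ∀ a b : ℝ, IntervalIntegrable k volume a b ∧ F b - F a = ∫ t in a..b, k t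

namespace IsLinePrimitive

variable {F G k l : ℝ → ℝ}

lemma add (hF : IsLinePrimitive F k) (hG : IsLinePrimitive G l) :
    IsLinePrimitive (fun x => F x + G x) (fun x => k x + l x) := fun a b => by
  obtain ⟨h1, h2⟩ := hF a b
  obtain ⟨h3, h4⟩ := hG a b
  refine ⟨h1.add h3, ?_⟩
  rw [intervalIntegral.integral_add h1 h3, ← h2, ← h4]; ring

lemma const_mul (c : ℝ) (hF : IsLinePrimitive F k) :
    IsLinePrimitive (fun x => c * F x) (fun x => c * k x) := fun a b => by
  obtain ⟨h1, h2⟩ := hF a b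
  refine ⟨h1.const_mul c, ?_⟩
  rw [intervalIntegral.integral_const_mul, ← h2]; ring

lemma isPrimitive (hF : IsLinePrimitive F k) : IsPrimitive F k := fun a b _ _ => hF a b

lemma comp_neg (hF : IsLinePrimitive F k) :
    IsLinePrimitive (fun x => -F (-x)) (fun x => k (-x)) := fun a b => by
  obtain ⟨h1, h2⟩ := hF (-b) (-a)
  refine ⟨?_, ?_⟩
  · have := h1.symm.comp_sub_left 0
    simpa using this
  · rw [intervalIntegral.integral_comp_neg, ← h2]; ring

lemma continuous (hF : IsLinePrimitive F k) : Continuous F := by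
  have h := intervalIntegral.continuous_primitive (fun a b => (hF a b).1) 0
  have h2 : F = fun x => F 0 + ∫ t in (0 : ℝ)..x, k t := by
    funext x; rw [← (hF 0 x).2]; ring
  rw [h2]
  exact continuous_const.add h

lemma of_hasDerivAt (h : ∀ x, HasDerivAt F (k x) x) (hk : Continuous k) :
    IsLinePrimitive F k := fun a b =>
  ⟨hk.intervalIntegrable a b, (intervalIntegral.integral_eq_sub_of_hasDerivAt
    (fun x _ => h x) (hk.intervalIntegrable a b)).symm⟩

end IsLinePrimitive

/-- A bounded continuous solution of `x u'' + r u' = lam (x u + g)` on the line. -/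
structure LineSol (r lam : ℝ) (g u : ℝ → ℝ) : Prop where
  continuous : Continuous u
  pos : HalfSol r lam g u (deriv u)
  neg : HalfSol r lam (fun x => -g (-x)) (fun x => u (-x)) (fun x => -deriv u (-x))

lemma continuousAt_zero_of_tendsto {f : ℝ → ℝ} (h1 : Tendsto f (𝓝[>] 0) (𝓝 (f 0)))
    (h2 : Tendsto (fun x => f (-x)) (𝓝[>] 0) (𝓝 (f 0))) : ContinuousAt f 0 := by
  rw [continuousAt_iff_punctured_nhds, ← nhdsLT_sup_nhdsGT, tendsto_sup]
  refine ⟨?_, h1⟩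
  have h3 : Tendsto (fun x : ℝ => -x) (𝓝[<] 0) (𝓝[>] 0) := by
    simpa using tendsto_neg_nhdsLT (a := (0 : ℝ))
  simpa [Function.comp_def] using h2.comp h3

namespace LineSol

variable {r lam : ℝ} {g u : ℝ → ℝ} (s : LineSol r lam g u)
include s

lemma hasDerivAt {x : ℝ} (hx : x ≠ 0) : HasDerivAt u (deriv u x) x := by
  rcases hx.lt_or_gt with hx | hx
  · have h := (s.neg.deriv (-x) (neg_pos.2 hx)).comp x (hasDerivAt_neg x)
    simp only [Function.comp_def, neg_neg] at h
    simpa using h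
  · exact s.pos.deriv x hx

lemma differentiableAt {x : ℝ} (hx : x ≠ 0) : DifferentiableAt ℝ u x :=
  (s.hasDerivAt hx).differentiableAt

lemma continuousAt_deriv {x : ℝ} (hx : x ≠ 0) : ContinuousAt (deriv u) x := by
  rcases hx.lt_or_gt with hx | hx
  · have h := (s.neg.continuousOn_deriv.continuousAt (Ioi_mem_nhds (neg_pos.2 hx))).neg
    have h2 := ContinuousAt.comp (f := fun x : ℝ => -x) (x := x) h continuous_neg.continuousAt
    simpa [Function.comp_def] using h2
  · exact s.pos.continuousOn_deriv.continuousAt (Ioi_mem_nhds hx)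

/-- At the origin the bound on `u` passes by continuity. The bound on `deriv u 0` needs no
differentiability there: the mean value theorem on either side gives a Lipschitz estimate at `0`. -/
lemma bounds {A B a b : ℝ → ℝ} {A₀ M : ℝ} (K : SteinKernel r lam A B a b A₀)
    (hg : ∀ x, |g x| ≤ M) : (∀ x, |u x| ≤ lam * M * (A₀ * ∫ t in Ioi 0, t ^ (r - 1) * B t)) ∧
      ∀ x, |deriv u x| ≤ 2 * lam * M / r := by
  have hM : 0 ≤ M := (abs_nonneg _).trans (hg 0)
  have hr := K.r_pos
  have hl := K.lam_pos
  have h1 := fun x (hx : 0 < x) => s.pos.bounds K (fun x _ => hg x) hx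
  have h2 := fun x (hx : 0 < x) => s.neg.bounds K (fun x _ => by rw [abs_neg]; exact hg (-x)) hx
  have h3 : ∀ x, x ≠ 0 → |deriv u x| ≤ 2 * lam * M / r := fun x hx => by
    rcases hx.lt_or_gt with hx | hx
    · simpa using (h2 (-x) (neg_pos.2 hx)).2
    · exact (h1 x hx).2
  refine ⟨fun x => ?_, fun x => ?_⟩
  · rcases lt_trichotomy x 0 with hx | rfl | hx
    · simpa using (h2 (-x) (neg_pos.2 hx)).1
    · refine le_of_tendsto ((s.continuous.abs.tendsto 0).mono_left
        (nhdsWithin_le_nhds (s := Ioi 0))) ?_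
      filter_upwards [self_mem_nhdsWithin] with x hx using (h1 x hx).1
    · exact (h1 x hx).1
  · rcases eq_or_ne x 0 with rfl | hx
    · rw [← Real.norm_eq_abs]
      refine norm_deriv_le_of_lip' (by positivity) (.of_forall fun y => ?_)
      have key : ∀ p q : ℝ, p < q → (0 ≤ p ∨ q ≤ 0) →
          |u q - u p| ≤ 2 * lam * M / r * (q - p) := fun p q hpq h0 => by
        obtain ⟨c, hc, he⟩ := exists_deriv_eq_slope u hpq s.continuous.continuousOn
          fun z hz => (s.differentiableAt (by
            rcases h0 with h0 | h0
            · exact (h0.trans_lt hz.1).ne'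
            · exact (hz.2.trans_le h0).ne)).differentiableWithinAt
        have hcb := h3 c (by
            rcases h0 with h0 | h0
            · exact (h0.trans_lt hc.1).ne'
            · exact (hc.2.trans_le h0).ne)
        rwa [he, abs_div, abs_of_pos (sub_pos.2 hpq), div_le_iff₀ (sub_pos.2 hpq)] at hcb
      rcases lt_trichotomy y 0 with hy | rfl | hy
      · rw [norm_sub_rev, sub_zero, Real.norm_eq_abs, Real.norm_eq_abs, abs_of_neg hy]
        simpa using key y 0 hy (Or.inr le_rfl)
      · simp
      · rw [sub_zero, Real.norm_eq_abs, Real.norm_eq_abs, abs_of_pos hy]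
        simpa using key 0 y hy (Or.inl le_rfl)
    · exact h3 x hx

/-- The one-sided limits of the derivative are forced by the equation and agree when `g` is
continuous at `0`; a continuous function whose derivative has a limit is differentiable there. -/
lemma hasDerivAt_zero (hr : 0 < r) (hl : 0 < lam) (hg : ContinuousAt g 0) :
    HasDerivAt u (lam * g 0 / r) 0 ∧ ContinuousAt (deriv u) 0 := by
  have h1 := s.pos.tendsto_deriv_zero hr hl (hg.tendsto.mono_left nhdsWithin_le_nhds)
  have hg' : Tendsto (fun x => -g (-x)) (𝓝[>] 0) (𝓝 (-g 0)) := by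
    have : ContinuousAt (fun x => -g (-x)) 0 :=
      (ContinuousAt.comp (f := fun x : ℝ => -x) (x := 0) (by simpa using hg)
        continuous_neg.continuousAt).neg
    simpa using this.tendsto.mono_left (nhdsWithin_le_nhds (s := Ioi 0))
  have h2 := (s.neg.tendsto_deriv_zero hr hl hg').neg
  simp only [neg_neg, mul_neg, neg_div] at h2
  have h3 : ContinuousAt (Function.update (deriv u) 0 (lam * g 0 / r)) 0 := by
    refine continuousAt_zero_of_tendsto ?_ ?_
    · rw [Function.update_self]
      refine h1.congr' ?_
      filter_upwards [self_mem_nhdsWithin] with x hx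
      rw [Function.update_of_ne (ne_of_gt hx)]
    · rw [Function.update_self]
      refine h2.congr' ?_
      filter_upwards [self_mem_nhdsWithin] with x hx
      rw [Function.update_of_ne (neg_ne_zero.2 (ne_of_gt hx))]
  have h4 := hasDerivAt_of_hasDerivAt_of_ne (f := u) (fun y hy => by
    rw [Function.update_of_ne hy]; exact s.hasDerivAt hy) s.continuous.continuousAt h3
  rw [Function.update_self] at h4
  refine ⟨h4, ?_⟩
  rwa [← h4.deriv, Function.update_eq_self] at h3

/-- The derivative of a solution on the line solves the equation with `r + 1`. -/
theorem derivative {A B a b g₁ : ℝ → ℝ} {A₀ M : ℝ} (K : SteinKernel r lam A B a b A₀)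
    (hg : ∀ x, |g x| ≤ M) (hp : IsLinePrimitive g g₁) :
    Differentiable ℝ u ∧ LineSol (r + 1) lam (fun x => g₁ x + u x) (deriv u) := by
  have hd0 := s.hasDerivAt_zero K.r_pos K.lam_pos hp.continuous.continuousAt
  have hb := (s.bounds K hg).2
  refine ⟨fun x => ?_, ?_, ?_, ?_⟩
  · rcases eq_or_ne x 0 with rfl | hx
    · exact hd0.1.differentiableAt
    · exact s.differentiableAt hx
  · refine continuous_iff_continuousAt.2 fun x => ?_
    rcases eq_or_ne x 0 with rfl | hx
    · exact hd0.2
    · exact s.continuousAt_deriv hx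
  · have h := s.pos.derivative K.r_pos hp.isPrimitive (fun x _ => hg x) ⟨_, fun x _ => hb x⟩
    exact h.congr (fun _ _ => rfl) (fun _ _ => rfl) fun x hx => (h.deriv x hx).deriv.symm
  · have h := s.neg.derivative K.r_pos hp.comp_neg.isPrimitive
      (fun x _ => by rw [abs_neg]; exact hg (-x)) ⟨_, fun x _ => by rw [abs_neg]; exact hb (-x)⟩
    refine h.neg.congr (fun _ _ => rfl) (fun _ _ => neg_neg _) fun x hx => ?_
    have e := (h.deriv x hx).deriv
    rw [deriv.fun_neg, deriv_comp_neg, neg_neg] at e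
    rw [e]

end LineSol

end LineSolutions

/-! ### The explicit formula as variation of parameters on both half lines. -/

section Solution
open Set Filter Topology

variable {r ν σ : ℝ}

lemma rpow_mul_besselK (hσ : 0 < σ) (hν : r = 2 * ν + 1) {t : ℝ} (ht : 0 < t) :
    t ^ ν * besselK ν (t / σ) = t ^ (r - 1) * vgKernelB ν σ t := by
  rw [besselK_div hσ ht, ← mul_assoc, ← Real.rpow_add ht]
  congr 2; linarith

lemma integrable_weight (hr : 0 < r) (hσ : 0 < σ) (hν : r = 2 * ν + 1) :
    Integrable (fun t : ℝ => |t| ^ ν * besselK ν (|t| / σ)) := by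
  have h1 : IntegrableOn (fun t : ℝ => |t| ^ ν * besselK ν (|t| / σ)) (Ioi 0) :=
    (vgKernel hr hσ hν).B_int.congr_fun (fun t ht => by
      rw [abs_of_pos ht, rpow_mul_besselK hσ hν ht]) measurableSet_Ioi
  have h2 : IntegrableOn (fun t : ℝ => |t| ^ ν * besselK ν (|t| / σ)) (Iic 0) := by
    rw [integrableOn_Iic_iff_integrableOn_Iio]
    have h3 : IntegrableOn (fun t : ℝ => |-t| ^ ν * besselK ν (|-t| / σ)) (Iio 0) :=
      IntegrableOn.comp_neg_Iio (f := fun t : ℝ => |t| ^ ν * besselK ν (|t| / σ))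
        (by simpa using h1)
    simpa using h3
  rw [← integrableOn_univ, ← Iic_union_Ioi (a := (0 : ℝ))]
  exact h2.union h1

lemma integral_weight (hr : 0 < r) (hσ : 0 < σ) (hν : r = 2 * ν + 1) :
    ∫ t : ℝ, |t| ^ ν * besselK ν (|t| / σ) =
      (2 * σ) ^ ν * σ * (√Real.pi * Real.Gamma (r / 2)) := by
  rw [integral_comp_abs (f := fun t : ℝ => t ^ ν * besselK ν (t / σ)),
    setIntegral_congr_fun measurableSet_Ioi fun t ht => rpow_mul_besselK hσ hν ht,
    integral_vgKernelB hr hσ hν]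
  ring

lemma vgDensity_eq (hσ : 0 < σ) (hν : r = 2 * ν + 1) (x : ℝ) :
    vgDensity r σ x = ((2 * σ) ^ ν * σ * (√Real.pi * Real.Gamma (r / 2)))⁻¹ *
      (|x| ^ ν * besselK ν (|x| / σ)) := by
  rw [vgDensity, show (r - 1) / 2 = ν by linarith, Real.div_rpow (abs_nonneg x) (by positivity)]
  field_simp

lemma integrable_weight_mul_vgCentred (hr : 0 < r) (hσ : 0 < σ) (hν : r = 2 * ν + 1) {h : ℝ → ℝ}
    (hm : Measurable h) {C : ℝ} (hC : ∀ x, |h x| ≤ C) :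
    Integrable fun t => |t| ^ ν * besselK ν (|t| / σ) * vgCentred r σ h t := by
  have hW := integrable_weight hr hσ hν
  have := (hW.mul_bdd (c := C) hm.aestronglyMeasurable (.of_forall hC)).sub
    (hW.mul_const (∫ y, h y * vgDensity r σ y))
  refine this.congr (.of_forall fun t => ?_)
  simp only [vgCentred, Pi.sub_apply]
  ring

/-- The centred test function has mean zero. -/
lemma integral_weight_mul_vgCentred (hr : 0 < r) (hσ : 0 < σ) (hν : r = 2 * ν + 1) {h : ℝ → ℝ}
    (hm : Measurable h) {C : ℝ} (hC : ∀ x, |h x| ≤ C) :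
    ∫ t : ℝ, |t| ^ ν * besselK ν (|t| / σ) * vgCentred r σ h t = 0 := by
  have hW := integrable_weight hr hσ hν
  have hI := hW.mul_bdd (c := C) hm.aestronglyMeasurable (.of_forall hC)
  have hG := Real.Gamma_pos_of_pos (by positivity : 0 < r / 2)
  have hc : 0 < (2 * σ) ^ ν * σ * (√Real.pi * Real.Gamma (r / 2)) := by
    have := Real.sqrt_pos.2 Real.pi_pos
    positivity
  have h1 : ∫ y, h y * vgDensity r σ y = ((2 * σ) ^ ν * σ * (√Real.pi * Real.Gamma (r / 2)))⁻¹ *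
      ∫ t : ℝ, |t| ^ ν * besselK ν (|t| / σ) * h t := by
    rw [← integral_const_mul]
    refine integral_congr_ae (.of_forall fun t => ?_)
    simp only [vgDensity_eq hσ hν]
    ring
  simp only [vgCentred, mul_sub]
  rw [integral_sub hI (hW.mul_const _), integral_mul_const, integral_weight hr hσ hν, h1]
  field_simp
  ring

lemma vgSolution_of_pos (hσ : 0 < σ) (hν : r = 2 * ν + 1) (h : ℝ → ℝ)
    {x : ℝ} (hx : 0 < x) : vgSolution r σ h x =
      -(1 / σ ^ 2) * (vgKernelB ν σ x *
        (∫ t in (0 : ℝ)..x, t ^ (r - 1) * vgKernelA ν σ t * vgCentred r σ h t) +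
        vgKernelA ν σ x * ∫ t in Ioi x, t ^ (r - 1) * vgKernelB ν σ t * vgCentred r σ h t) := by
  have e1 : ∫ t in (0 : ℝ)..x, |t| ^ ν * besselI ν (|t| / σ) * vgCentred r σ h t =
      ∫ t in (0 : ℝ)..x, t ^ (r - 1) * vgKernelA ν σ t * vgCentred r σ h t := by
    rw [intervalIntegral.integral_of_le hx.le, intervalIntegral.integral_of_le hx.le]
    refine setIntegral_congr_fun measurableSet_Ioc fun t ht => ?_
    rw [abs_of_pos ht.1, rpow_mul_besselI hσ ht.1, show r - 1 = 2 * ν by linarith]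
  have e2 : ∫ t in Ioi x, |t| ^ ν * besselK ν (|t| / σ) * vgCentred r σ h t =
      ∫ t in Ioi x, t ^ (r - 1) * vgKernelB ν σ t * vgCentred r σ h t := by
    refine setIntegral_congr_fun measurableSet_Ioi fun t ht => ?_
    have ht : 0 < t := hx.trans ht
    rw [abs_of_pos ht, rpow_mul_besselK hσ hν ht]
  have h0 := Real.rpow_pos_of_pos hx ν
  simp only [vgSolution, show (r - 1) / 2 = ν by linarith, if_neg hx.ne']
  rw [e1, e2, abs_of_pos hx, besselK_div hσ hx, besselI_div hσ hx]
  field_simp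
  ring

/-- Mean zero turns the integral over `(-x, ∞)` into minus the integral over `(-∞, -x)`, and
reflection gives the half-line formula with `-h̃(-t)`. -/
lemma vgSolution_neg (hr : 0 < r) (hσ : 0 < σ) (hν : r = 2 * ν + 1) {h : ℝ → ℝ}
    (hm : Measurable h) {C : ℝ} (hC : ∀ x, |h x| ≤ C) {x : ℝ} (hx : 0 < x) :
    vgSolution r σ h (-x) =
      -(1 / σ ^ 2) * (vgKernelB ν σ x *
        (∫ t in (0 : ℝ)..x, t ^ (r - 1) * vgKernelA ν σ t * -vgCentred r σ h (-t)) +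
        vgKernelA ν σ x * ∫ t in Ioi x, t ^ (r - 1) * vgKernelB ν σ t * -vgCentred r σ h (-t)) := by
  have hI := integrable_weight_mul_vgCentred hr hσ hν hm hC
  have e1 : ∫ t in (0 : ℝ)..(-x), |t| ^ ν * besselI ν (|t| / σ) * vgCentred r σ h t =
      ∫ t in (0 : ℝ)..x, t ^ (r - 1) * vgKernelA ν σ t * -vgCentred r σ h (-t) := by
    rw [intervalIntegral.integral_symm]
    have := intervalIntegral.integral_comp_neg (a := 0) (b := x)
      (fun t => |t| ^ ν * besselI ν (|t| / σ) * vgCentred r σ h t)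
    rw [neg_zero] at this
    rw [← this, ← intervalIntegral.integral_neg, intervalIntegral.integral_of_le hx.le,
      intervalIntegral.integral_of_le hx.le]
    refine setIntegral_congr_fun measurableSet_Ioc fun t ht => ?_
    rw [abs_neg, abs_of_pos ht.1, rpow_mul_besselI hσ ht.1, show r - 1 = 2 * ν by linarith]
    ring
  have e2 : ∫ t in Ioi (-x), |t| ^ ν * besselK ν (|t| / σ) * vgCentred r σ h t =
      ∫ t in Ioi x, t ^ (r - 1) * vgKernelB ν σ t * -vgCentred r σ h (-t) := by
    have h1 := intervalIntegral.integral_Iic_add_Ioi (b := -x) hI.integrableOn hI.integrableOn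
    rw [integral_weight_mul_vgCentred hr hσ hν hm hC] at h1
    rw [eq_neg_of_add_eq_zero_right h1, ← integral_comp_neg_Ioi, ← integral_neg]
    refine setIntegral_congr_fun measurableSet_Ioi fun t ht => ?_
    have ht : 0 < t := hx.trans ht
    rw [abs_neg, abs_of_pos ht, rpow_mul_besselK hσ hν ht]
    ring
  have h0 := Real.rpow_pos_of_pos hx ν
  simp only [vgSolution, show (r - 1) / 2 = ν by linarith, if_neg (neg_ne_zero.2 hx.ne')]
  rw [e1, e2, abs_neg, abs_of_pos hx, besselK_div hσ hx, besselI_div hσ hx]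
  field_simp
  ring

/-- The two expressions are the limits from the right and from the left; they coincide because `h̃`
has mean zero. -/
lemma vgSolution_zero (hr : 0 < r) (hσ : 0 < σ) (hν : r = 2 * ν + 1) {h : ℝ → ℝ}
    (hm : Measurable h) {C : ℝ} (hC : ∀ x, |h x| ≤ C) :
    vgSolution r σ h 0 = -(1 / σ ^ 2) * ((2 * σ) ^ (-ν) * (1 / Real.Gamma (ν + 1)) *
        ∫ t in Ioi 0, t ^ (r - 1) * vgKernelB ν σ t * vgCentred r σ h t) ∧
    vgSolution r σ h 0 = -(1 / σ ^ 2) * ((2 * σ) ^ (-ν) * (1 / Real.Gamma (ν + 1)) *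
        ∫ t in Ioi 0, t ^ (r - 1) * vgKernelB ν σ t * -vgCentred r σ h (-t)) := by
  have hI := integrable_weight_mul_vgCentred hr hσ hν hm hC
  have e0 : vgSolution r σ h 0 = -(1 / σ ^ 2) * ((2 * σ) ^ (-ν) * (1 / Real.Gamma (ν + 1)) *
      ∫ t in Ioi 0, |t| ^ ν * besselK ν (|t| / σ) * vgCentred r σ h t) := by
    simp only [vgSolution, show (r - 1) / 2 = ν by linarith, if_true]
    rw [Real.rpow_neg (by positivity)]
    have := Real.Gamma_pos_of_pos (by linarith : 0 < ν + 1)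
    field_simp
  have e2 : ∫ t in Ioi 0, |t| ^ ν * besselK ν (|t| / σ) * vgCentred r σ h t =
      ∫ t in Ioi 0, t ^ (r - 1) * vgKernelB ν σ t * vgCentred r σ h t := by
    refine setIntegral_congr_fun measurableSet_Ioi fun t ht => ?_
    have ht : 0 < t := ht
    rw [abs_of_pos ht, rpow_mul_besselK hσ hν ht]
  have e3 : ∫ t in Ioi 0, |t| ^ ν * besselK ν (|t| / σ) * vgCentred r σ h t =
      ∫ t in Ioi 0, t ^ (r - 1) * vgKernelB ν σ t * -vgCentred r σ h (-t) := by
    have h1 := intervalIntegral.integral_Iic_add_Ioi (b := 0) hI.integrableOn hI.integrableOn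
    rw [integral_weight_mul_vgCentred hr hσ hν hm hC] at h1
    have h2 := integral_comp_neg_Ioi (0 : ℝ)
      (fun t => |t| ^ ν * besselK ν (|t| / σ) * vgCentred r σ h t)
    rw [neg_zero] at h2
    rw [eq_neg_of_add_eq_zero_right h1, ← h2, ← integral_neg]
    refine setIntegral_congr_fun measurableSet_Ioi fun t ht => ?_
    have ht : 0 < t := ht
    rw [abs_neg, abs_of_pos ht, rpow_mul_besselK hσ hν ht]
    ring
  exact ⟨by rw [e0, e2], by rw [e0, e3]⟩

lemma vgCentred_bdd {h : ℝ → ℝ} {C : ℝ} (hC : ∀ x, |h x| ≤ C) (x : ℝ) :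
    |vgCentred r σ h x| ≤ C + |∫ y, h y * vgDensity r σ y| :=
  (abs_sub _ _).trans (add_le_add (hC x) le_rfl)

/-- The explicit solution solves the Stein equation on the line. -/
theorem vgSolution_lineSol (hr : 0 < r) (hσ : 0 < σ) {h : ℝ → ℝ}
    (hm : Measurable h) {C : ℝ} (hC : ∀ x, |h x| ≤ C) :
    LineSol r (1 / σ ^ 2) (vgCentred r σ h) (vgSolution r σ h) := by
  obtain ⟨ν, hν⟩ : ∃ ν, r = 2 * ν + 1 := ⟨(r - 1) / 2, by ring⟩
  have K := vgKernel hr hσ hν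
  have hgm : Measurable (vgCentred r σ h) := hm.sub_const _
  have hgm' : Measurable fun x => -vgCentred r σ h (-x) := (hgm.comp measurable_neg).neg
  have hb : ∀ x, 0 < x → |vgCentred r σ h x| ≤ C + |∫ y, h y * vgDensity r σ y| :=
    fun x _ => vgCentred_bdd hC x
  have hb' : ∀ x, 0 < x → |-vgCentred r σ h (-x)| ≤ C + |∫ y, h y * vgDensity r σ y| :=
    fun x _ => by rw [abs_neg]; exact vgCentred_bdd hC (-x)
  have h1 := K.halfSol hgm hb
  have h2 := K.halfSol hgm' hb'
  have l1 := K.tendsto_solution_zero hgm hb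
  have l2 := K.tendsto_solution_zero hgm' hb'
  have f1 := fun x (hx : 0 < x) => (vgSolution_of_pos hσ hν h hx).symm
  have f2 := fun x (hx : 0 < x) => (vgSolution_neg hr hσ hν hm hC hx).symm
  obtain ⟨z1, z2⟩ := vgSolution_zero hr hσ hν hm hC
  have p := h1.congr (u' := vgSolution r σ h) (v' := deriv (vgSolution r σ h))
    (fun _ _ => rfl) f1 fun x hx => by
      rw [← (h1.deriv x hx).deriv]
      refine EventuallyEq.deriv_eq ?_
      filter_upwards [Ioi_mem_nhds hx] with y hy using f1 y hy
  have n := h2.congr (u' := fun x => vgSolution r σ h (-x))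
    (v' := fun x => -deriv (vgSolution r σ h) (-x)) (fun _ _ => rfl) f2 fun x hx => by
      rw [← (h2.deriv x hx).deriv, ← deriv_comp_neg]
      refine EventuallyEq.deriv_eq ?_
      filter_upwards [Ioi_mem_nhds hx] with y hy using f2 y hy
  refine ⟨continuous_iff_continuousAt.2 fun x => ?_, p, n⟩
  rcases lt_trichotomy x 0 with hx | rfl | hx
  · have hc := n.continuousOn.continuousAt (Ioi_mem_nhds (neg_pos.2 hx))
    have := ContinuousAt.comp (f := fun x : ℝ => -x) (x := x) hc continuous_neg.continuousAt
    simpa [Function.comp_def] using this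
  · refine continuousAt_zero_of_tendsto ?_ ?_
    · rw [z1]
      exact l1.congr' (by filter_upwards [self_mem_nhdsWithin] with x hx using f1 x hx)
    · rw [z2]
      exact l2.congr' (by filter_upwards [self_mem_nhdsWithin] with x hx using f2 x hx)
  · exact p.continuousOn.continuousAt (Ioi_mem_nhds hx)

end Solution

/-! ### The Stein equation, regularity, and the bounds on the derivatives. -/

section SteinEquation
open Set Filter Topology

variable {r σ : ℝ}

lemma exists_abs_le_of_memCb {n : ℕ} {h : ℝ → ℝ} (hh : MemCb n h) : ∃ C, ∀ x, |h x| ≤ C := by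
  simpa using hh.bounded 0 (Nat.zero_le n)

lemma continuousAt_vgCentred {h : ℝ → ℝ} {x : ℝ} (hx : ContinuousAt h x) :
    ContinuousAt (vgCentred r σ h) x := hx.sub continuousAt_const

lemma steinOp_of_hasDerivAt (hσ : 0 < σ) {f g : ℝ → ℝ} {x : ℝ} (hx : x ≠ 0)
    (h : HasDerivAt (deriv f) (1 / σ ^ 2 * (x * f x + g x) / x - r * deriv f x / x) x) :
    DifferentiableAt ℝ (deriv f) x ∧ vgSteinOp r σ f x = g x := by
  refine ⟨h.differentiableAt, ?_⟩
  rw [vgSteinOp, h.deriv]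
  field_simp
  ring

lemma hasDerivAt_of_reflect {f : ℝ → ℝ} {x c : ℝ}
    (h : HasDerivAt (fun x => -f (-x)) c (-x)) : HasDerivAt f c x := by
  have h1 := (h.comp x (hasDerivAt_neg x)).fun_neg
  simpa [Function.comp_def] using h1

/-- The explicit solution solves the Stein equation. -/
theorem vgSolution_isVGSteinSolution (hr : 0 < r) (hσ : 0 < σ) {h : ℝ → ℝ} (hh : MemCb 0 h) :
    IsVGSteinSolution r σ h (vgSolution r σ h) := by
  obtain ⟨C, hC⟩ := exists_abs_le_of_memCb hh
  have s := vgSolution_lineSol hr hσ hh.measurable hC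
  refine ⟨s.continuous, fun x hx => s.differentiableAt hx, ?_, fun x hx => ?_⟩
  · have h1 := s.pos.ae_hasDerivAt_deriv
    -- Reflection preserves null sets, so the almost-everywhere statement on the positive axis
    -- transfers to the negative one.
    have h2 := (quasiMeasurePreserving_neg volume).ae s.neg.ae_hasDerivAt_deriv
    filter_upwards [h1, h2, measure_eq_zero_iff_ae_notMem.1 (Real.volume_singleton (a := 0))]
      with x hx1 hx2 hx0
    have hx0 : x ≠ 0 := hx0
    refine steinOp_of_hasDerivAt hσ hx0 ?_
    rcases hx0.lt_or_gt with hx | hx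
    · refine (hasDerivAt_of_reflect (hx2 (neg_pos.2 hx))).congr_deriv ?_
      simp only [neg_neg]
      field_simp
      ring
    · exact hx1 hx
  · rcases lt_trichotomy x 0 with hx0 | rfl | hx0
    · refine ⟨s.differentiableAt hx0.ne, ?_⟩
      have hg₀ : ContinuousAt (vgCentred r σ h) (- -x) := by
        rw [neg_neg]; exact continuousAt_vgCentred hx
      have hg : ContinuousAt (fun x => -vgCentred r σ h (-x)) (-x) :=
        (ContinuousAt.comp (f := fun x : ℝ => -x) (x := -x)
          hg₀ continuous_neg.continuousAt).neg
      have h1 := steinOp_of_hasDerivAt (r := r) (g := vgCentred r σ h) hσ hx0.ne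
        ((hasDerivAt_of_reflect (s.neg.hasDerivAt_deriv (neg_pos.2 hx0) hg)).congr_deriv (by
          simp only [neg_neg]
          field_simp
          ring))
      exact ⟨fun _ => h1.1, h1.2⟩
    · have h1 := (s.hasDerivAt_zero hr (by positivity) (continuousAt_vgCentred hx)).1
      refine ⟨h1.differentiableAt, fun hc => absurd rfl hc, ?_⟩
      rw [vgSteinOp, h1.deriv]
      field_simp
      ring
    · have h1 := steinOp_of_hasDerivAt hσ hx0.ne'
        (s.pos.hasDerivAt_deriv hx0 (continuousAt_vgCentred hx))
      exact ⟨s.differentiableAt hx0.ne', fun _ => h1.1, h1.2⟩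

lemma iteratedDeriv_vgCentred (h : ℝ → ℝ) (m : ℕ) :
    iteratedDeriv (m + 1) (vgCentred r σ h) = iteratedDeriv (m + 1) h := by
  have : deriv (vgCentred r σ h) = deriv h := by
    funext x
    exact deriv_sub_const _
  rw [iteratedDeriv_succ', iteratedDeriv_succ', this]

/-- Absolute continuity is an assumption only at the top order; below it, a bounded derivative makes
the function Lipschitz. -/
lemma MemCb.isLinePrimitive {n m : ℕ} {h : ℝ → ℝ} (hh : MemCb n h) (hm : m < n) :
    IsLinePrimitive (iteratedDeriv m h) (iteratedDeriv (m + 1) h) := fun a b => by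
  have hac : AbsolutelyContinuousOnInterval (iteratedDeriv m h) a b := by
    rcases eq_or_ne (m + 1) n with e | e
    · exact hh.absolutelyContinuous m e a b
    · obtain ⟨C, hC⟩ := hh.bounded (m + 1) hm
      have hC0 : 0 ≤ C := (abs_nonneg _).trans (hC 0)
      have hl : LipschitzWith ⟨C, hC0⟩ (iteratedDeriv m h) :=
        lipschitzWith_of_nnnorm_deriv_le (hh.differentiable m (by omega)) fun x => by
          rw [← iteratedDeriv_succ]
          exact hC x
      exact (hl.lipschitzOnWith (s := uIcc a b)).absolutelyContinuousOnInterval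
  rw [iteratedDeriv_succ]
  exact ⟨hac.intervalIntegrable_deriv, hac.integral_deriv_eq_sub.symm⟩

lemma isLinePrimitive_vgCentred {n m : ℕ} {h : ℝ → ℝ} (hh : MemCb n h) (hm : m < n) :
    IsLinePrimitive (iteratedDeriv m (vgCentred r σ h))
      (iteratedDeriv (m + 1) (vgCentred r σ h)) := by
  rw [iteratedDeriv_vgCentred]
  rcases m with _ | m
  · refine fun a b => ⟨(hh.isLinePrimitive hm a b).1, ?_⟩
    rw [← (hh.isLinePrimitive hm a b).2]
    simp [vgCentred]
  · rw [iteratedDeriv_vgCentred]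
    exact hh.isLinePrimitive hm

lemma abs_iteratedDeriv_vgCentred_le {n m : ℕ} {h : ℝ → ℝ} (hh : MemCb n h) (hm : m ≤ n) (x : ℝ) :
    |iteratedDeriv m (vgCentred r σ h) x| ≤ supNorm (iteratedDeriv m (vgCentred r σ h)) := by
  have hb : ∃ C, ∀ x, |iteratedDeriv m (vgCentred r σ h) x| ≤ C := by
    rcases m with _ | m
    · obtain ⟨C, hC⟩ := exists_abs_le_of_memCb hh
      exact ⟨_, fun x => by simpa using vgCentred_bdd hC x⟩
    · rw [iteratedDeriv_vgCentred]
      exact hh.bounded _ hm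
  obtain ⟨C, hC⟩ := hb
  exact le_ciSup (f := fun x => |iteratedDeriv m (vgCentred r σ h) x|)
    ⟨C, by rintro _ ⟨y, rfl⟩; exact hC y⟩ x

/-- The derivatives of the solution solve Stein equations with shifted parameter. -/
theorem iteratedDeriv_lineSol {n : ℕ} {h : ℝ → ℝ} (hr : 0 < r) (hσ : 0 < σ) (hh : MemCb n h)
    (m : ℕ) (hm : m ≤ n) :
    LineSol (r + m) (1 / σ ^ 2) (fun x => iteratedDeriv m (vgCentred r σ h) x +
        m * iteratedDeriv (m - 1) (vgSolution r σ h) x) (iteratedDeriv m (vgSolution r σ h)) ∧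
      ∀ i < m, Differentiable ℝ (iteratedDeriv i (vgSolution r σ h)) ∧
        ∃ C, ∀ x, |iteratedDeriv i (vgSolution r σ h) x| ≤ C := by
  induction m with
  | zero =>
    obtain ⟨C, hC⟩ := exists_abs_le_of_memCb hh
    refine ⟨?_, fun i hi => absurd hi (Nat.not_lt_zero i)⟩
    simpa using vgSolution_lineSol hr hσ hh.measurable hC
  | succ m ih =>
    obtain ⟨s, hd⟩ := ih (by omega)
    have K := vgKernel (r := r + m) (ν := (r + m - 1) / 2) (by positivity) hσ (by ring)
    have hp : IsLinePrimitive (fun x => iteratedDeriv m (vgCentred r σ h) x +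
        m * iteratedDeriv (m - 1) (vgSolution r σ h) x)
        (fun x => iteratedDeriv (m + 1) (vgCentred r σ h) x +
          m * iteratedDeriv m (vgSolution r σ h) x) := by
      refine (isLinePrimitive_vgCentred hh hm).add ?_
      -- For `m = 0` the truncated index `m - 1` is harmless, as its coefficient is `0`.
      rcases m with _ | m
      · intro a b; simp
      · refine IsLinePrimitive.const_mul _ (.of_hasDerivAt (fun x => ?_) s.continuous)
        rw [iteratedDeriv_succ]
        exact ((hd m (Nat.lt_succ_self m)).1 x).hasDerivAt
    have hbd : ∃ M, ∀ x, |iteratedDeriv m (vgCentred r σ h) x +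
        m * iteratedDeriv (m - 1) (vgSolution r σ h) x| ≤ M := by
      have h1 := abs_iteratedDeriv_vgCentred_le (r := r) (σ := σ) hh (by omega : m ≤ n)
      rcases m with _ | m
      · exact ⟨_, fun x => by simpa using h1 x⟩
      · obtain ⟨C, hC⟩ := (hd m (Nat.lt_succ_self m)).2
        refine ⟨_ + (m + 1 : ℕ) * C, fun x => (abs_add_le _ _).trans (add_le_add (h1 x) ?_)⟩
        rw [abs_mul, Nat.abs_cast]
        exact mul_le_mul_of_nonneg_left (hC x) (Nat.cast_nonneg _)
    obtain ⟨M, hM⟩ := hbd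
    obtain ⟨h1, h2⟩ := s.derivative K hM hp
    refine ⟨?_, fun i hi => ?_⟩
    · rw [iteratedDeriv_succ (f := vgSolution r σ h)]
      convert h2 using 1
      · push_cast; ring
      · funext x
        rw [add_tsub_cancel_right]
        push_cast; ring
    · rcases Nat.lt_succ_iff_lt_or_eq.1 hi with hi | rfl
      · exact hd i hi
      · exact ⟨h1, _, (s.bounds K hM).1⟩

theorem vgSolution_contDiff {n : ℕ} {h : ℝ → ℝ} (hr : 0 < r) (hσ : 0 < σ) (hh : MemCb n h) :
    ContDiff ℝ (n : WithTop ℕ∞) (vgSolution r σ h) ∧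
      ∀ x : ℝ, x ≠ 0 → DifferentiableAt ℝ (iteratedDeriv n (vgSolution r σ h)) x := by
  refine ⟨contDiff_nat_iff_iteratedDeriv.2 ⟨fun m hm => ?_, fun m hm => ?_⟩, fun x hx => ?_⟩
  · exact (iteratedDeriv_lineSol hr hσ hh m hm).1.continuous
  · exact ((iteratedDeriv_lineSol hr hσ hh n le_rfl).2 m hm).1
  · exact (iteratedDeriv_lineSol hr hσ hh n le_rfl).1.differentiableAt hx

/-- The first-order recursion for the bounds. -/
theorem abs_iteratedDeriv_succ_le {n m : ℕ} {h : ℝ → ℝ} (hr : 0 < r) (hσ : 0 < σ)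
    (hh : MemCb n h) (hm : m ≤ n) {D : ℝ}
    (hD : ∀ x, m * |iteratedDeriv (m - 1) (vgSolution r σ h) x| ≤ D) (x : ℝ) :
    |iteratedDeriv (m + 1) (vgSolution r σ h) x| ≤
      2 / σ ^ 2 / (r + m) * (supNorm (iteratedDeriv m (vgCentred r σ h)) + D) := by
  have s := (iteratedDeriv_lineSol hr hσ hh m hm).1
  have K := vgKernel (r := r + m) (ν := (r + m - 1) / 2) (by positivity) hσ (by ring)
  have h1 := (s.bounds K (M := supNorm (iteratedDeriv m (vgCentred r σ h)) + D) fun x => ?_).2 x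
  · rw [iteratedDeriv_succ]
    exact h1.trans_eq (by ring)
  · refine (abs_add_le _ _).trans (add_le_add (abs_iteratedDeriv_vgCentred_le hh hm x) ?_)
    rw [abs_mul, Nat.abs_cast]
    exact hD x

lemma pochhammerK_succ (x : ℝ) (n : ℕ) (k : ℝ) :
    pochhammerK x (n + 1) k = pochhammerK x n k * (x + n * k) :=
  Finset.prod_range_succ _ _

lemma pochhammerK_pos {x : ℝ} (hx : 0 < x) (n : ℕ) : 0 < pochhammerK x n 2 :=
  Finset.prod_pos fun i _ => by positivity

/-- Raising `k` multiplies the coefficient by exactly the factor from two applications of the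
differentiation step, so the recursion for the bounds closes with equality. -/
lemma vgOddCoeff_succ (r σ : ℝ) {k j : ℕ} (hj : j ≤ k) :
    vgOddCoeff r σ (k + 1) j =
      2 / σ ^ 2 / (r + (2 * k + 2 : ℕ)) * ((2 * k + 2 : ℕ) * vgOddCoeff r σ k j) := by
  simp only [vgOddCoeff]
  rw [show k + 1 - j + 1 = k - j + 1 + 1 by omega, pochhammerK_succ, pow_succ,
    show 2 * (k + 1) = 2 * k + 2 by ring, Nat.doubleFactorial_add_two]
  have e : r + 2 * (j : ℝ) + ((k - j + 1 : ℕ) : ℝ) * 2 = r + (2 * k + 2 : ℕ) := by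
    push_cast [Nat.cast_sub hj]; ring
  rw [e]
  push_cast
  simp only [mul_inv, div_eq_mul_inv]
  ring

lemma vgEvenCoeff_succ (r σ : ℝ) {k j : ℕ} (hj : 1 ≤ j) (hjk : j ≤ k) :
    vgEvenCoeff r σ (k + 1) j =
      2 / σ ^ 2 / (r + (2 * k + 1 : ℕ)) * ((2 * k + 1 : ℕ) * vgEvenCoeff r σ k j) := by
  simp only [vgEvenCoeff]
  obtain ⟨l, rfl⟩ : ∃ l, k = l + 1 := ⟨k - 1, by omega⟩
  rw [show l + 1 + 1 - j + 1 = l + 1 - j + 1 + 1 by omega, pochhammerK_succ, pow_succ,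
    show 2 * (l + 1 + 1) - 1 = 2 * l + 1 + 2 by omega, Nat.doubleFactorial_add_two,
    show 2 * (l + 1) - 1 = 2 * l + 1 by omega]
  have e : r + 2 * (j : ℝ) - 1 + ((l + 1 - j + 1 : ℕ) : ℝ) * 2 = r + (2 * (l + 1) + 1 : ℕ) := by
    push_cast [Nat.cast_sub hjk]; ring
  rw [e]
  push_cast
  simp only [mul_inv, div_eq_mul_inv]
  ring

lemma vgEvenRem_succ (r σ : ℝ) (k : ℕ) :
    vgEvenRem r σ (k + 1) =
      2 / σ ^ 2 / (r + (2 * k + 1 : ℕ)) * ((2 * k + 1 : ℕ) * vgEvenRem r σ k) := by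
  simp only [vgEvenRem]
  have hdf : (2 * (k + 1) - 1)‼ = (2 * k + 1) * (2 * k - 1)‼ := by
    rcases k with _ | k
    · rfl
    · rw [show 2 * (k + 1 + 1) - 1 = 2 * k + 1 + 2 by omega, Nat.doubleFactorial_add_two,
        show 2 * (k + 1) - 1 = 2 * k + 1 by omega]
      ring
  have e : r + 1 + (k : ℝ) * 2 = r + (2 * k + 1 : ℕ) := by push_cast; ring
  rw [hdf, pochhammerK_succ, e, show 2 * (k + 1) + 1 = 2 * k + 1 + 2 by ring, pow_add σ _ 2]
  push_cast
  simp only [mul_inv, div_eq_mul_inv, pow_succ]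
  ring

/-- The bounds for the derivatives of odd order. -/
theorem abs_iteratedDeriv_odd_le {n : ℕ} {h : ℝ → ℝ} (hr : 0 < r) (hσ : 0 < σ)
    (hh : MemCb n h) (k : ℕ) (hk : 2 * k ≤ n) (x : ℝ) :
    |iteratedDeriv (2 * k + 1) (vgSolution r σ h) x| ≤ ∑ j ∈ Finset.range (k + 1),
      vgOddCoeff r σ k j * supNorm (iteratedDeriv (2 * j) (vgCentred r σ h)) := by
  induction k generalizing x with
  | zero =>
    have h1 := abs_iteratedDeriv_succ_le hr hσ hh (Nat.zero_le n) (D := 0) (by simp) x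
    refine h1.trans_eq ?_
    simp [vgOddCoeff, pochhammerK]
    exact Or.inl (by ring)
  | succ k ih =>
    have h1 := abs_iteratedDeriv_succ_le hr hσ hh hk (D := (2 * k + 2 : ℕ) *
      ∑ j ∈ Finset.range (k + 1),
        vgOddCoeff r σ k j * supNorm (iteratedDeriv (2 * j) (vgCentred r σ h)))
      (fun x => mul_le_mul_of_nonneg_left (ih (by omega) x) (Nat.cast_nonneg _)) x
    refine h1.trans_eq ?_
    rw [Finset.sum_range_succ _ (k + 1), mul_add, Finset.mul_sum, Finset.mul_sum, add_comm]
    congr 1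
    · refine Finset.sum_congr rfl fun j hj => ?_
      rw [vgOddCoeff_succ r σ (Nat.lt_succ_iff.1 (Finset.mem_range.1 hj))]
      ring_nf
    · have h2 : ((2 * (k + 1))‼ : ℝ) ≠ 0 := by exact_mod_cast (Nat.doubleFactorial_pos _).ne'
      simp only [vgOddCoeff, pochhammerK, Nat.sub_self, zero_add, Finset.range_one,
        Finset.prod_singleton, div_self h2]
      push_cast
      ring

/-- The uniform bound for the solution. -/
theorem abs_vgSolution_le {n : ℕ} {h : ℝ → ℝ} (hr : 0 < r) (hσ : 0 < σ) (hh : MemCb n h) (x : ℝ) :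
    |vgSolution r σ h x| ≤ vgEvenRem r σ 0 * supNorm (vgCentred r σ h) := by
  obtain ⟨C, hC⟩ := exists_abs_le_of_memCb hh
  have hs := abs_iteratedDeriv_vgCentred_le (r := r) (σ := σ) hh (Nat.zero_le n)
  simp only [iteratedDeriv_zero] at hs
  have hS : 0 ≤ supNorm (vgCentred r σ h) := (abs_nonneg _).trans (hs 0)
  have hν : r = 2 * ((r - 1) / 2) + 1 := by ring
  have h1 := ((vgSolution_lineSol hr hσ hh.measurable hC).bounds (vgKernel hr hσ hν) hs).1 x
  rw [integral_vgKernelB hr hσ hν, show (r - 1) / 2 + 1 = (r + 1) / 2 by ring] at h1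
  refine h1.trans ?_
  have hG := Real.Gamma_pos_of_pos (by positivity : 0 < r / 2)
  have hG' := Real.Gamma_pos_of_pos (by positivity : 0 < (r + 1) / 2)
  -- The argument gives the constant with `√π` and without `1 / r`; the stated one is larger.
  have hpi : √Real.pi ≤ Real.pi := by
    rw [Real.sqrt_le_left Real.pi_pos.le]
    nlinarith [Real.pi_gt_three]
  have hc : (0 : ℝ) < (2 * σ) ^ ((r - 1) / 2) := by positivity
  calc _ = σ⁻¹ * (√Real.pi * Real.Gamma (r / 2) / (2 * Real.Gamma ((r + 1) / 2))) *
        supNorm (vgCentred r σ h) := by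
        rw [Real.rpow_neg (by positivity)]
        field_simp
    _ ≤ σ⁻¹ * (1 / r + Real.pi * Real.Gamma (r / 2) / (2 * Real.Gamma ((r + 1) / 2))) *
        supNorm (vgCentred r σ h) := by
        gcongr
        have : 0 ≤ 1 / r := by positivity
        have h3 : √Real.pi * Real.Gamma (r / 2) / (2 * Real.Gamma ((r + 1) / 2)) ≤
          Real.pi * Real.Gamma (r / 2) / (2 * Real.Gamma ((r + 1) / 2)) := by gcongr
        linarith
    _ = _ := by simp [vgEvenRem, pochhammerK]

/-- The bounds for the derivatives of even order. -/
theorem abs_iteratedDeriv_even_le {n : ℕ} {h : ℝ → ℝ} (hr : 0 < r) (hσ : 0 < σ)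
    (hh : MemCb n h) (k : ℕ) (hk : 2 * k - 1 ≤ n) (x : ℝ) :
    |iteratedDeriv (2 * k) (vgSolution r σ h) x| ≤ ∑ j ∈ Finset.Icc 1 k,
        vgEvenCoeff r σ k j * supNorm (iteratedDeriv (2 * j - 1) h) +
      vgEvenRem r σ k * supNorm (vgCentred r σ h) := by
  induction k generalizing x with
  | zero => simpa using abs_vgSolution_le hr hσ hh x
  | succ k ih =>
    have h1 := abs_iteratedDeriv_succ_le hr hσ hh (m := 2 * k + 1) (by omega)
      (D := (2 * k + 1 : ℕ) * (∑ j ∈ Finset.Icc 1 k,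
        vgEvenCoeff r σ k j * supNorm (iteratedDeriv (2 * j - 1) h) +
        vgEvenRem r σ k * supNorm (vgCentred r σ h)))
      (fun x => mul_le_mul_of_nonneg_left (ih (by omega) x) (Nat.cast_nonneg _)) x
    refine h1.trans_eq ?_
    have hsum : ∑ j ∈ Finset.Icc 1 k,
        vgEvenCoeff r σ (k + 1) j * supNorm (iteratedDeriv (2 * j - 1) h) =
        2 / σ ^ 2 / (r + (2 * k + 1 : ℕ)) * ((2 * k + 1 : ℕ) * ∑ j ∈ Finset.Icc 1 k,
          vgEvenCoeff r σ k j * supNorm (iteratedDeriv (2 * j - 1) h)) := by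
      rw [Finset.mul_sum, Finset.mul_sum]
      refine Finset.sum_congr rfl fun j hj => ?_
      obtain ⟨hj1, hj2⟩ := Finset.mem_Icc.1 hj
      rw [vgEvenCoeff_succ r σ hj1 hj2]
      ring
    have h2 : ((2 * (k + 1) - 1)‼ : ℝ) ≠ 0 := by exact_mod_cast (Nat.doubleFactorial_pos _).ne'
    have h3 : vgEvenCoeff r σ (k + 1) (k + 1) = 2 / σ ^ 2 / (r + (2 * k + 1 : ℕ)) := by
      simp only [vgEvenCoeff, pochhammerK, Nat.sub_self, zero_add, Finset.range_one,
        Finset.prod_singleton, div_self h2]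
      push_cast
      ring
    rw [Finset.sum_Icc_succ_top (by omega), iteratedDeriv_vgCentred, vgEvenRem_succ r σ k, hsum,
      h3, show 2 * (k + 1) - 1 = 2 * k + 1 by omega]
    ring

end SteinEquation

/-! ### Decay of the coefficients. -/

section Coefficients

lemma vgOddCoeff_self (r σ : ℝ) (k : ℕ) : vgOddCoeff r σ k k = 2 / σ ^ 2 / (r + 2 * k) := by
  have h : ((2 * k)‼ : ℝ) ≠ 0 := by exact_mod_cast (Nat.doubleFactorial_pos _).ne'
  simp only [vgOddCoeff, pochhammerK, Nat.sub_self, zero_add, Finset.range_one,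
    Finset.prod_singleton, div_self h, Nat.cast_zero, zero_mul, add_zero, pow_one]
  ring

lemma vgEvenCoeff_self (r σ : ℝ) (k : ℕ) :
    vgEvenCoeff r σ k k = 2 / σ ^ 2 / (r + 2 * k - 1) := by
  have h : ((2 * k - 1)‼ : ℝ) ≠ 0 := by exact_mod_cast (Nat.doubleFactorial_pos _).ne'
  simp only [vgEvenCoeff, pochhammerK, Nat.sub_self, zero_add, Finset.range_one,
    Finset.prod_singleton, div_self h, Nat.cast_zero, zero_mul, add_zero, pow_one]
  ring

/-- One step away from the diagonal, the coefficient gains a factor at most `2 / σ²`. -/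
lemma vgOddCoeff_le {r σ : ℝ} (hr : 0 < r) (j m : ℕ) :
    vgOddCoeff r σ (j + m) j ≤ (2 / σ ^ 2) ^ (m + 1) / (r + 2 * j) := by
  induction m with
  | zero => simp [vgOddCoeff_self]
  | succ m ih =>
    rw [← add_assoc, vgOddCoeff_succ r σ (Nat.le_add_right j m)]
    have h1 : ((2 * (j + m) + 2 : ℕ) : ℝ) / (r + (2 * (j + m) + 2 : ℕ)) ≤ 1 := by
      rw [div_le_one (by positivity)]; linarith
    calc _ = ((2 * (j + m) + 2 : ℕ) : ℝ) / (r + (2 * (j + m) + 2 : ℕ)) *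
          (2 / σ ^ 2 * vgOddCoeff r σ (j + m) j) := by ring
      _ ≤ ((2 * (j + m) + 2 : ℕ) : ℝ) / (r + (2 * (j + m) + 2 : ℕ)) *
          (2 / σ ^ 2 * ((2 / σ ^ 2) ^ (m + 1) / (r + 2 * j))) := by gcongr
      _ ≤ 1 * (2 / σ ^ 2 * ((2 / σ ^ 2) ^ (m + 1) / (r + 2 * j))) := by gcongr
      _ = _ := by ring

lemma vgEvenCoeff_le {r σ : ℝ} (hr : 0 < r) {j : ℕ} (hj : 1 ≤ j) (m : ℕ) :
    vgEvenCoeff r σ (j + m) j ≤ (2 / σ ^ 2) ^ (m + 1) / (r + 2 * j - 1) := by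
  have hj' : (1 : ℝ) ≤ j := by exact_mod_cast hj
  have h0 : 0 < r + 2 * j - 1 := by linarith
  induction m with
  | zero => simp [vgEvenCoeff_self]
  | succ m ih =>
    rw [← add_assoc, vgEvenCoeff_succ r σ hj (Nat.le_add_right j m)]
    have h1 : ((2 * (j + m) + 1 : ℕ) : ℝ) / (r + (2 * (j + m) + 1 : ℕ)) ≤ 1 := by
      rw [div_le_one (by positivity)]; linarith
    calc _ = ((2 * (j + m) + 1 : ℕ) : ℝ) / (r + (2 * (j + m) + 1 : ℕ)) *
          (2 / σ ^ 2 * vgEvenCoeff r σ (j + m) j) := by ring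
      _ ≤ ((2 * (j + m) + 1 : ℕ) : ℝ) / (r + (2 * (j + m) + 1 : ℕ)) *
          (2 / σ ^ 2 * ((2 / σ ^ 2) ^ (m + 1) / (r + 2 * j - 1))) := by gcongr
      _ ≤ 1 * (2 / σ ^ 2 * ((2 / σ ^ 2) ^ (m + 1) / (r + 2 * j - 1))) := by gcongr
      _ = _ := by ring

theorem leading_coeff_ge {σ : ℝ} (hσ : 0 < σ) : ∃ c : ℝ, 0 < c ∧ ∀ r : ℝ, 0 < r → ∀ k : ℕ,
    c / (r + (2 * k + 1)) ≤ vgOddCoeff r σ k k ∧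
      (1 ≤ k → c / (r + 2 * k) ≤ vgEvenCoeff r σ k k) := by
  refine ⟨2 / σ ^ 2, by positivity, fun r hr k => ⟨?_, fun hk => ?_⟩⟩
  · rw [vgOddCoeff_self]
    gcongr
    linarith
  · have hk' : (1 : ℝ) ≤ k := by exact_mod_cast hk
    rw [vgEvenCoeff_self]
    gcongr
    · linarith
    · linarith

/-- Each of the `m` steps off the diagonal multiplies by `2 / σ²` times a ratio `i / (r + i) ≤ 1`,
so only the diagonal denominator at `j = k - m` matters. -/
theorem lower_coeff_le (σ : ℝ) (m : ℕ) : ∃ C R : ℝ, ∀ r : ℝ, 0 < r → ∀ k : ℕ,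
    (m ≤ k → R ≤ r + (2 * k + 1) → vgOddCoeff r σ k (k - m) ≤ C / (r + (2 * k + 1))) ∧
      (m + 1 ≤ k → R ≤ r + 2 * k → vgEvenCoeff r σ k (k - m) ≤ C / (r + 2 * k)) := by
  have hc : 0 ≤ (2 / σ ^ 2) ^ (m + 1) := by positivity
  -- The threshold `4 * m + 2` is exactly what makes `r + n` at most twice the denominator `r + 2j`
  -- or `r + 2j - 1`; hence the factor `2`.
  refine ⟨2 * (2 / σ ^ 2) ^ (m + 1), 4 * m + 2, fun r hr k => ⟨fun hk hR => ?_, fun hk hR => ?_⟩⟩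
  · obtain ⟨j, rfl⟩ : ∃ j, k = j + m := ⟨k - m, by omega⟩
    rw [Nat.add_sub_cancel]
    refine (vgOddCoeff_le hr j m).trans ?_
    push_cast at hR ⊢
    rw [div_le_div_iff₀ (by positivity) (by positivity)]
    nlinarith
  · obtain ⟨j, rfl⟩ : ∃ j, k = j + m := ⟨k - m, by omega⟩
    rw [Nat.add_sub_cancel]
    have hj : 1 ≤ j := by omega
    have hj' : (1 : ℝ) ≤ j := by exact_mod_cast hj
    refine (vgEvenCoeff_le hr hj m).trans ?_
    push_cast at hR ⊢
    rw [div_le_div_iff₀ (by linarith) (by positivity)]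
    nlinarith

theorem vgEvenRem_le {σ : ℝ} (hσ : 0 < σ) (k : ℕ) (hk : 1 ≤ k) :
    ∃ C R : ℝ, ∀ r : ℝ, R ≤ r → 0 < r → vgEvenRem r σ k ≤ C / (r + 2 * k) := by
  obtain ⟨l, rfl⟩ : ∃ l, k = l + 1 := ⟨k - 1, by omega⟩
  -- For `r ≥ 4` both `r / 2` and `(r + 1) / 2` lie where `Γ` increases, so the Gamma ratio is at
  -- most `1`, and also `1 / r ≤ 1`. One factor `r + 1` of the Pochhammer symbol gives the decay,
  -- and `2 * (l + 1)` converts `1 / (r + 1)` into `1 / (r + 2k)`.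
  refine ⟨((2 * (l + 1) - 1)‼ : ℝ) * 2 ^ (l + 1) / σ ^ (2 * (l + 1) + 1) * (1 + Real.pi / 2) *
    (2 * (l + 1)), 4, fun r hr hr0 => ?_⟩
  have hp : r + 1 ≤ pochhammerK (r + 1) (l + 1) 2 := by
    clear hk
    induction l with
    | zero => simp [pochhammerK]
    | succ l ih =>
      rw [pochhammerK_succ]
      have h1 : (0 : ℝ) ≤ ((l + 1 : ℕ) : ℝ) * 2 := by positivity
      exact ih.trans (le_mul_of_one_le_right (pochhammerK_pos (by linarith) _).le (by linarith))
  have hG : Real.Gamma (r / 2) ≤ Real.Gamma ((r + 1) / 2) :=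
    Real.Gamma_strictMonoOn_Ici.monotoneOn (Set.mem_Ici.2 (by linarith))
      (Set.mem_Ici.2 (by linarith)) (by linarith)
  have hG0 : 0 < Real.Gamma ((r + 1) / 2) := Real.Gamma_pos_of_pos (by linarith)
  have hb : 1 / r + Real.pi * Real.Gamma (r / 2) / (2 * Real.Gamma ((r + 1) / 2)) ≤
      1 + Real.pi / 2 := by
    refine add_le_add ((div_le_one hr0).2 (by linarith)) ?_
    rw [div_le_div_iff₀ (by positivity) two_pos]
    nlinarith [Real.pi_pos]
  have hG1 : 0 < Real.Gamma (r / 2) := Real.Gamma_pos_of_pos (by linarith)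
  have hpi := Real.pi_pos
  have hl : (0 : ℝ) ≤ l := Nat.cast_nonneg l
  calc vgEvenRem r σ (l + 1) ≤ ((2 * (l + 1) - 1)‼ : ℝ) * 2 ^ (l + 1) /
        ((r + 1) * σ ^ (2 * (l + 1) + 1)) * (1 + Real.pi / 2) := by
        rw [vgEvenRem]
        gcongr
    _ = ((2 * (l + 1) - 1)‼ : ℝ) * 2 ^ (l + 1) / σ ^ (2 * (l + 1) + 1) * (1 + Real.pi / 2) *
        (1 / (r + 1)) := by
        field_simp
    _ ≤ ((2 * (l + 1) - 1)‼ : ℝ) * 2 ^ (l + 1) / σ ^ (2 * (l + 1) + 1) * (1 + Real.pi / 2) *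
        (2 * (l + 1) / (r + 2 * (l + 1))) := by
        gcongr ?_ * ?_
        rw [div_le_div_iff₀ (by linarith) (by linarith)]
        nlinarith
    _ = _ := by push_cast; ring

end Coefficients

/-- Bounds for all derivatives of the solution `f` of the `VG(r, 0, σ, 0)` Stein equation, for test
functions `h ∈ C_b^{n-1}(ℝ)`, `n = 2k + 1` or `n = 2k` (for `n = 0` the truncated `2 * k - 1 = 0`
asks that `h` be bounded and measurable), and the decay of their coefficients. -/
theorem mainTheorem5 (σ : ℝ) (hσ : 0 < σ) :
    -- `f` solves the Stein equation, and the bounds on its derivatives of odd and even order hold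
    (∀ r : ℝ, 0 < r → ∀ h : ℝ → ℝ,
      (MemCb 0 h → IsVGSteinSolution r σ h (vgSolution r σ h)) ∧
      (∀ k : ℕ, MemCb (2 * k) h →
        ContDiff ℝ ((2 * k : ℕ) : WithTop ℕ∞) (vgSolution r σ h) ∧
        (∀ x : ℝ, x ≠ 0 →
          DifferentiableAt ℝ (iteratedDeriv (2 * k) (vgSolution r σ h)) x) ∧
        ∀ x : ℝ, |iteratedDeriv (2 * k + 1) (vgSolution r σ h) x| ≤
          ∑ j ∈ Finset.range (k + 1),
            vgOddCoeff r σ k j * supNorm (iteratedDeriv (2 * j) (vgCentred r σ h))) ∧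
      (∀ k : ℕ, MemCb (2 * k - 1) h →
        ContDiff ℝ ((2 * k - 1 : ℕ) : WithTop ℕ∞) (vgSolution r σ h) ∧
        (∀ x : ℝ, x ≠ 0 →
          DifferentiableAt ℝ (iteratedDeriv (2 * k - 1) (vgSolution r σ h)) x) ∧
        ∀ x : ℝ, |iteratedDeriv (2 * k) (vgSolution r σ h) x| ≤
          ∑ j ∈ Finset.Icc 1 k,
            vgEvenCoeff r σ k j * supNorm (iteratedDeriv (2 * j - 1) h) +
          vgEvenRem r σ k * supNorm (vgCentred r σ h))) ∧
    -- the leading coefficients have exact order `(r + n)⁻¹`, `n = 2k + 1` and `n = 2k`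
    (∃ c : ℝ, 0 < c ∧ ∀ r : ℝ, 0 < r → ∀ k : ℕ,
      c / (r + (2 * k + 1)) ≤ vgOddCoeff r σ k k ∧
      (1 ≤ k → c / (r + 2 * k) ≤ vgEvenCoeff r σ k k)) ∧
    -- the coefficient `m` places below the leading one is `O((r + n)⁻¹)` as `r + n → ∞`
    (∀ m : ℕ, ∃ C R : ℝ, ∀ r : ℝ, 0 < r → ∀ k : ℕ,
      (m ≤ k → R ≤ r + (2 * k + 1) →
        vgOddCoeff r σ k (k - m) ≤ C / (r + (2 * k + 1))) ∧
      (m + 1 ≤ k → R ≤ r + 2 * k →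
        vgEvenCoeff r σ k (k - m) ≤ C / (r + 2 * k))) ∧
    -- for each even order `n = 2k ≥ 2` the coefficient of `‖h̃‖` is `O((r + n)⁻¹)` as `r → ∞`
    (∀ k : ℕ, 1 ≤ k → ∃ C R : ℝ, ∀ r : ℝ, R ≤ r → 0 < r →
      vgEvenRem r σ k ≤ C / (r + 2 * k)) := by
  refine ⟨fun r hr h => ⟨vgSolution_isVGSteinSolution hr hσ, fun k hh => ?_, fun k hh => ?_⟩,
    leading_coeff_ge hσ, lower_coeff_le σ, vgEvenRem_le hσ⟩
  · obtain ⟨h1, h2⟩ := vgSolution_contDiff hr hσ hh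
    exact ⟨h1, h2, abs_iteratedDeriv_odd_le hr hσ hh k le_rfl⟩
  · obtain ⟨h1, h2⟩ := vgSolution_contDiff hr hσ hh
    exact ⟨h1, h2, abs_iteratedDeriv_even_le hr hσ hh k le_rfl⟩
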